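/- Let $k$ be an algebraically closed field of characteristic $p>0$ and let $e,f,h$ be the standard basis of $\mathfrak{sl}_2(k)$. For an integer $\lambda\ge 0$ let $V(\lambda)$ be the Weyl module: the $\mathfrak{sl}_2$-module with basis $v_0,\dots,v_\lambda$ and action $ev_j=(\lambda-j+1)v_{j-1}$, $fv_j=(j+1)v_{j+1}$, $hv_j=(\lambda-2j)v_j$ (with $v_{-1}=v_{\lambda+1}=0$). Identify the projectivized restricted nullcone $\{xy+z^2=0\}$ of $\mathfrak{sl}_2$ (where $x,y,z$ are the coordinates dual to $e,f,h$) with $\mathbb P^1=\operatorname{Proj}k[s,t]$ via $[s:t]\mapsto[s^2:-t^2:st]$. For a finite-dimensional $\mathfrak{sl}_2$-module $M$ let $\widetilde M=\mathcal O_{\mathbb P^1}\otimes_k M$ and let $$\Theta_M=s^2\otimes e-t^2\otimes f+st\otimes h\colon\ \widetilde M\to\widetilde M(2)$$ be the global operator. Let $\mathcal K(M)\subseteq\widetilde M$ be the kernel of $\Theta_M$ and, for $j\ge 0$, let $\mathcal I^j(M)\subseteq\widetilde M$ be the image of the $j$-fold composite of twists of $\Theta_M$, $\widetilde M(-2j)\to\widetilde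 M(-2j+2)\to\cdots\to\widetilde M$. For $1\le i\le p$ put $$\mathscr F_i(M)=\frac{\mathcal K(M)\cap\mathcal I^{i-1}(M)}{\mathcal K(M)\cap\mathcal I^{i}(M)},$$ a sheaf of $\mathcal O_{\mathbb P^1}$-modules. If $V(\lambda)$ is indecomposable and $1\le i<p$, then $$\mathscr F_i(V(\lambda))\simeq\begin{cases}\mathcal O_{\mathbb P^1}(-\lambda)&\text{if } i\equiv\lambda+1\pmod p,\\ 0&\text{otherwise.}\end{cases}$$ -/

import Mathlib

noncomputable section
open CategoryTheory Limits TopologicalSpace Opposite AlgebraicGeometry TensorProduct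

namespace ProjTilde
universe u
variable {k A : Type u} [Field k] [CommRing A] [Algebra k A]
  (𝒜 : ℕ → Submodule k A) [GradedAlgebra 𝒜]

/-- A module over the graded ring `𝒜` together with its homogeneous pieces `deg j`, `j : ℤ`,
which satisfy `𝒜 i • deg j ⊆ deg (i + j)`. -/
structure GradedMod where
  carrier : Type u
  [addCommGroup : AddCommGroup carrier]
  [module : Module A carrier]
  deg : ℤ → AddSubgroup carrier
  smul_mem : ∀ {i : ℕ} {j : ℤ} {a : A} {m : carrier}, a ∈ 𝒜 i → m ∈ deg j → a • m ∈ deg (i + j)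

attribute [instance] GradedMod.addCommGroup GradedMod.module

variable {𝒜}
variable (N N' : GradedMod 𝒜)

instance isPrime_top (x : ProjectiveSpectrum.top 𝒜) :
    (HomogeneousIdeal.toIdeal (ProjectiveSpectrum.asHomogeneousIdeal x)).IsPrime := x.isPrime

/-- The localization of `N` at the homogeneous prime `x`. -/
abbrev Fiber (x : ProjectiveSpectrum.top 𝒜) : Type u :=
  LocalizedModule x.asHomogeneousIdeal.toIdeal.primeCompl N.carrier

/-- `s` is a fraction `m / b` on `U`, with `m ∈ N` and `b ∈ A` homogeneous of the same degree and
`b` outside all the primes in `U`. -/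
def isFractionPrelocal : TopCat.PrelocalPredicate (Fiber N) where
  pred {U} s := ∃ (i : ℕ) (m : N.carrier) (b : A), m ∈ N.deg i ∧ b ∈ 𝒜 i ∧
    ∀ x : U, ∃ hb : b ∉ x.1.asHomogeneousIdeal.toIdeal, s x = LocalizedModule.mk m ⟨b, hb⟩
  res := by
    rintro V U i f ⟨d, m, b, hm, hb, w⟩
    exact ⟨d, m, b, hm, hb, fun x => w (i x)⟩

def isLocallyFraction : TopCat.LocalPredicate (Fiber N) := (isFractionPrelocal N).sheafify

/-- The sections over `U` of the sheaf associated with `N`: the functions `s(x) ∈ N_x`, `x ∈ U`, that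
are locally a fraction `m / b` with `m`, `b` homogeneous of the same degree. -/
def sections (U : Opens (ProjectiveSpectrum.top 𝒜)) :
    AddSubgroup (∀ x : U, Fiber N x.1) where
  carrier := {s | (isLocallyFraction N).pred s}
  zero_mem' x := ⟨U, x.2, 𝟙 _, 0, 0, 1, zero_mem _, SetLike.GradedOne.one_mem, fun y =>
    ⟨y.1.asHomogeneousIdeal.toIdeal.primeCompl.one_mem, (LocalizedModule.zero_mk _).symm⟩⟩
  add_mem' {s t} hs ht x := by
    obtain ⟨V, hV, iV, i, m, b, hm, hb, w⟩ := hs x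
    obtain ⟨V', hV', iV', i', m', b', hm', hb', w'⟩ := ht x
    refine ⟨V ⊓ V', ⟨hV, hV'⟩, Opens.infLELeft _ _ ≫ iV, i + i', b' • m + b • m', b * b', ?_,
      SetLike.GradedMul.mul_mem hb hb', fun y => ?_⟩
    · push_cast
      refine add_mem ?_ (N.smul_mem hb hm')
      rw [add_comm]; exact N.smul_mem hb' hm
    · obtain ⟨h, e⟩ := w ⟨y.1, y.2.1⟩
      obtain ⟨h', e'⟩ := w' ⟨y.1, y.2.2⟩
      exact ⟨y.1.asHomogeneousIdeal.toIdeal.primeCompl.mul_mem h h',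
        (congrArg₂ (· + ·) e e').trans (LocalizedModule.mk_add_mk ..)⟩
  neg_mem' {s} hs x := by
    obtain ⟨V, hV, iV, i, m, b, hm, hb, w⟩ := hs x
    refine ⟨V, hV, iV, i, -m, b, neg_mem hm, hb, fun y => ?_⟩
    obtain ⟨h, e⟩ := w y
    exact ⟨h, (congrArg Neg.neg e).trans (LocalizedModule.mk_neg ..).symm⟩

theorem smul_mem_sections (U : Opens (ProjectiveSpectrum.top 𝒜))
    (r : ∀ x : U, HomogeneousLocalization.AtPrime 𝒜 x.1.asHomogeneousIdeal.toIdeal)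
    (hr : (ProjectiveSpectrum.StructureSheaf.isLocallyFraction 𝒜).pred r)
    (s : ∀ x : U, Fiber N x.1) (hs : s ∈ sections N U) :
    (fun x => (r x).val • s x : ∀ x : U, Fiber N x.1) ∈ sections N U := by
  intro x
  obtain ⟨V, hV, iV, i, m, b, hm, hb, w⟩ := hs x
  obtain ⟨V', hV', iV', i', a, c, hc, w'⟩ := hr x
  refine ⟨V ⊓ V', ⟨hV, hV'⟩, Opens.infLELeft _ _ ≫ iV, i' + i, a.1 • m, c.1 * b, ?_,
    SetLike.GradedMul.mul_mem c.2 hb, fun y => ?_⟩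
  · push_cast; exact N.smul_mem a.2 hm
  · obtain ⟨h, e⟩ := w ⟨y.1, y.2.1⟩
    have e' := w' ⟨y.1, y.2.2⟩
    refine ⟨y.1.asHomogeneousIdeal.toIdeal.primeCompl.mul_mem (hc ⟨y.1, y.2.2⟩) h, ?_⟩
    refine (congrArg₂ (fun a b => HomogeneousLocalization.val a • b) e' e).trans ?_
    rw [HomogeneousLocalization.val_mk]
    exact LocalizedModule.mk_smul_mk ..


def presheafAb : TopCat.Presheaf AddCommGrpCat (ProjectiveSpectrum.top 𝒜) where
  obj U := AddCommGrpCat.of (sections N U.unop)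
  map {U V} i := AddCommGrpCat.ofHom
    { toFun := fun s => ⟨fun x => s.1 (i.unop x), (isLocallyFraction N).res i.unop s.1 s.2⟩
      map_zero' := rfl
      map_add' := fun _ _ => rfl }

theorem presheafAb_isSheaf : (presheafAb N).IsSheaf :=
  (TopCat.Presheaf.isSheaf_iff_isSheaf_comp (forget AddCommGrpCat) _).2
    (TopCat.subpresheafToTypes.isSheaf (isLocallyFraction N))

/-- Sections of the structure sheaf of `Proj` act pointwise. -/
instance sectionsModule (U : (Opens (ProjectiveSpectrum.top 𝒜))ᵒᵖ) :
    Module ((ProjectiveSpectrum.Proj.structureSheaf 𝒜).1.obj U) (sections N U.unop) where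
  smul r s := ⟨_, smul_mem_sections N U.unop r.1 r.2 s.1 s.2⟩
  one_smul s := Subtype.ext <| funext fun x =>
    (congrArg (· • s.1 x) HomogeneousLocalization.val_one).trans (one_smul _ _)
  mul_smul _ _ s := Subtype.ext <| funext fun x =>
    (congrArg (· • s.1 x) (HomogeneousLocalization.val_mul _ _)).trans (mul_smul _ _ _)
  smul_zero _ := Subtype.ext <| funext fun _ => smul_zero _
  smul_add _ _ _ := Subtype.ext <| funext fun _ => smul_add _ _ _
  add_smul _ _ s := Subtype.ext <| funext fun x =>
    (congrArg (· • s.1 x) (HomogeneousLocalization.val_add _ _)).trans (add_smul _ _ _)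
  zero_smul s := Subtype.ext <| funext fun x =>
    (congrArg (· • s.1 x) HomogeneousLocalization.val_zero).trans (zero_smul _ _)

def modulePresheaf : (Proj 𝒜).PresheafOfModules :=
  letI (U : (Opens (Proj 𝒜))ᵒᵖ) :
    Module ((Proj 𝒜).ringCatSheaf.obj.obj U) ((presheafAb N).obj U) := sectionsModule N U
  .ofPresheaf (R := (Proj 𝒜).ringCatSheaf.obj) (presheafAb N) fun _ _ _ _ _ => rfl

/-- The sheaf of modules on `Proj 𝒜` associated with the graded module `N`. -/
def tilde : (Proj 𝒜).Modules where
  val := modulePresheaf N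
  isSheaf := presheafAb_isSheaf N

variable {N N'} in
/-- The localization at `x` of an `A`-linear map. -/
def fiberMap (φ : N.carrier →ₗ[A] N'.carrier) (x : ProjectiveSpectrum.top 𝒜) :
    Fiber N x →ₗ[Localization x.asHomogeneousIdeal.toIdeal.primeCompl] Fiber N' x :=
  LocalizedModule.map x.asHomogeneousIdeal.toIdeal.primeCompl φ

variable {N N'} in
theorem fiberMap_mem_sections (φ : N.carrier →ₗ[A] N'.carrier)
    (hφ : ∀ (i : ℤ) (m : N.carrier), m ∈ N.deg i → φ m ∈ N'.deg i)
    (U : Opens (ProjectiveSpectrum.top 𝒜)) (s : ∀ x : U, Fiber N x.1) (hs : s ∈ sections N U) :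
    (fun x => fiberMap φ x.1 (s x) : ∀ x : U, Fiber N' x.1) ∈ sections N' U := by
  intro x
  obtain ⟨V, hV, iV, i, m, b, hm, hb, w⟩ := hs x
  refine ⟨V, hV, iV, i, φ m, b, hφ _ _ hm, hb, fun y => ?_⟩
  obtain ⟨h, e⟩ := w y
  exact ⟨h, (congrArg (fiberMap φ y.1) e).trans (LocalizedModule.map_mk _ φ m _)⟩

variable {N N'} in
/-- The morphism of sheaves of modules induced by a degree-preserving linear map. -/
def tildeMap (φ : N.carrier →ₗ[A] N'.carrier)
    (hφ : ∀ (i : ℤ) (m : N.carrier), m ∈ N.deg i → φ m ∈ N'.deg i) : tilde N ⟶ tilde N' where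
  val := PresheafOfModules.homMk
    { app := fun U => AddCommGrpCat.ofHom
        { toFun := fun s => ⟨_, fiberMap_mem_sections φ hφ U.unop s.1 s.2⟩
          map_zero' := Subtype.ext <| funext fun x => map_zero (fiberMap φ x.1)
          map_add' := fun s t => Subtype.ext <| funext fun x =>
            map_add (fiberMap φ x.1) (s.1 x) (t.1 x) } }
    (fun U r s => Subtype.ext <| funext fun x => map_smul (fiberMap φ x.1) _ _)

end ProjTilde

namespace WeylSheaf
universe u
open MvPolynomial ProjTilde
open scoped Matrix

section Rep
attribute [local instance] LieRing.ofAssociativeRing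
variable (k : Type u) [Field k]

/-- The Lie algebra of `2 × 2` matrices of trace zero. -/
abbrev sl2 : Type u := LieAlgebra.SpecialLinear.sl (Fin 2) k

def e : sl2 k := ⟨!![0, 1; 0, 0], by simp [LieAlgebra.SpecialLinear.sl]⟩
def f : sl2 k := ⟨!![0, 0; 1, 0], by simp [LieAlgebra.SpecialLinear.sl]⟩
def h : sl2 k := ⟨!![1, 0; 0, -1], by simp [LieAlgebra.SpecialLinear.sl]⟩

variable (lam : ℕ)

/-- The matrix of `e` on the Weyl module: `e v_j = (λ - j + 1) v_{j-1}`. -/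
def weylE : Matrix (Fin (lam + 1)) (Fin (lam + 1)) k :=
  .of fun i j => if i.val + 1 = j.val then (lam : k) - j.val + 1 else 0
/-- The matrix of `f` on the Weyl module: `f v_j = (j + 1) v_{j+1}`. -/
def weylF : Matrix (Fin (lam + 1)) (Fin (lam + 1)) k :=
  .of fun i j => if i.val = j.val + 1 then (j.val : k) + 1 else 0
/-- The matrix of `h` on the Weyl module: `h v_j = (λ - 2j) v_j`. -/
def weylH : Matrix (Fin (lam + 1)) (Fin (lam + 1)) k :=
  .diagonal fun j => (lam : k) - 2 * j.val

theorem lie_weylH_weylE : ⁅weylH k lam, weylE k lam⁆ = (2 : k) • weylE k lam := by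
  ext i j
  simp only [Ring.lie_def, weylH, weylE, Matrix.sub_apply, Matrix.diagonal_mul,
    Matrix.mul_diagonal, Matrix.of_apply, Matrix.smul_apply, smul_eq_mul]
  split_ifs with hij
  · rw [← hij]; push_cast; ring
  · ring

theorem lie_weylH_weylF : ⁅weylH k lam, weylF k lam⁆ = (-2 : k) • weylF k lam := by
  ext i j
  simp only [Ring.lie_def, weylH, weylF, Matrix.sub_apply, Matrix.diagonal_mul,
    Matrix.mul_diagonal, Matrix.of_apply, Matrix.smul_apply, smul_eq_mul]
  split_ifs with hij
  · rw [hij]; push_cast; ring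
  · ring

theorem weylE_mul_weylF :
    weylE k lam * weylF k lam = .diagonal fun j => ((j.val : k) + 1) * (lam - j.val) := by
  ext i j
  simp only [Matrix.mul_apply, weylE, weylF, Matrix.of_apply, ite_mul, zero_mul, mul_ite, mul_zero,
    Matrix.diagonal_apply]
  by_cases hi : i.val < lam
  · rw [Finset.sum_eq_single (⟨i.val + 1, by omega⟩ : Fin (lam + 1))]
    · by_cases hij : i = j
      · subst hij; simp; ring
      · have : i.val ≠ j.val := fun h => hij (Fin.ext h)
        simp [hij, this]
    · intro b _ hb
      have : i.val + 1 ≠ b.val := fun h => hb (Fin.ext h.symm)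
      simp [this]
    · simp
  · have hi' : i.val = lam := by omega
    rw [Finset.sum_eq_zero]
    · by_cases hij : i = j <;> simp [hij]
      subst hij; simp [hi']
    · intro b _
      have : i.val + 1 ≠ b.val := by omega
      simp [this]

theorem weylF_mul_weylE :
    weylF k lam * weylE k lam = .diagonal fun j => (j.val : k) * (lam - j.val + 1) := by
  ext i j
  simp only [Matrix.mul_apply, weylE, weylF, Matrix.of_apply, ite_mul, zero_mul, mul_ite, mul_zero,
    Matrix.diagonal_apply]
  by_cases hi : 0 < i.val
  · rw [Finset.sum_eq_single (⟨i.val - 1, by omega⟩ : Fin (lam + 1))]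
    · have h1 : i.val - 1 + 1 = i.val := by omega
      by_cases hij : i = j
      · subst hij; simp [h1, ← Nat.cast_add_one]
      · have : i.val ≠ j.val := fun h => hij (Fin.ext h)
        simp [hij, this, h1]
    · intro b _ hb
      have : i.val ≠ b.val + 1 := fun h => hb (Fin.ext (by simp [h]))
      simp [this]
    · simp
  · have hi' : i.val = 0 := by omega
    rw [Finset.sum_eq_zero]
    · by_cases hij : i = j <;> simp [hij]
      subst hij; simp [hi']
    · intro b _
      have : i.val ≠ b.val + 1 := by omega
      simp [this]

theorem lie_weylE_weylF : ⁅weylE k lam, weylF k lam⁆ = weylH k lam := by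
  rw [Ring.lie_def, weylE_mul_weylF, weylF_mul_weylE, Matrix.diagonal_sub, weylH]
  congr 1; ext j; ring

/-- The matrix by which an element `a = a₀₁ e + a₁₀ f + a₀₀ h` acts on the Weyl module. -/
def weylMatrix : sl2 k →ₗ⁅k⁆ Matrix (Fin (lam + 1)) (Fin (lam + 1)) k where
  toFun a := a.1 0 1 • weylE k lam + a.1 1 0 • weylF k lam + a.1 0 0 • weylH k lam
  map_add' a b := by
    change (a.1 0 1 + b.1 0 1) • _ + (a.1 1 0 + b.1 1 0) • _ + (a.1 0 0 + b.1 0 0) • _ = _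
    module
  map_smul' c a := by
    change (c * a.1 0 1) • _ + (c * a.1 1 0) • _ + (c * a.1 0 0) • _ = c • _
    module
  map_lie' {a b} := by
    have htr : ∀ c : sl2 k, c.1 1 1 = - c.1 0 0 := fun c => by
      have hc : Matrix.trace c.1 = 0 := c.2
      rw [Matrix.trace_fin_two] at hc
      exact eq_neg_of_add_eq_zero_right hc
    have hHE := lie_weylH_weylE k lam
    have hHF := lie_weylH_weylF k lam
    have hEF := lie_weylE_weylF k lam
    have hEH : ⁅weylE k lam, weylH k lam⁆ = (-2 : k) • weylE k lam := by
      rw [← lie_skew, hHE, neg_smul]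
    have hFH : ⁅weylF k lam, weylH k lam⁆ = (2 : k) • weylF k lam := by
      rw [← lie_skew, hHF, neg_smul, neg_neg]
    have hFE : ⁅weylF k lam, weylE k lam⁆ = - weylH k lam := by
      rw [← lie_skew, hEF]
    simp only [LieAlgebra.SpecialLinear.sl_bracket, Matrix.sub_apply, Matrix.mul_apply,
      Fin.sum_univ_two, htr, add_lie, lie_add, smul_lie, lie_smul, lie_self, hHE, hHF, hEF, hEH,
      hFH, hFE]
    module

/-- The Weyl module `V(λ)`, with basis `v_0, …, v_λ` the standard basis of `k^(λ+1)`. -/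
def weylRep : sl2 k →ₗ⁅k⁆ Module.End k (Fin (lam + 1) → k) :=
  (lieEquivMatrix' (R := k) (n := Fin (lam + 1))).symm.toLieHom.comp (weylMatrix k lam)

theorem weylRep_e : weylRep k lam (e k) = Matrix.toLin' (weylE k lam) := by
  change Matrix.toLin' ((1 : k) • weylE k lam + (0 : k) • weylF k lam + (0 : k) • weylH k lam) = _
  congr 1; module

theorem weylRep_f : weylRep k lam (f k) = Matrix.toLin' (weylF k lam) := by
  change Matrix.toLin' ((0 : k) • weylE k lam + (1 : k) • weylF k lam + (0 : k) • weylH k lam) = _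
  congr 1; module

theorem weylRep_h : weylRep k lam (h k) = Matrix.toLin' (weylH k lam) := by
  change Matrix.toLin' ((0 : k) • weylE k lam + (0 : k) • weylF k lam + (1 : k) • weylH k lam) = _
  congr 1; module

variable {k} {M : Type u} [AddCommGroup M] [Module k M]

/-- A module is indecomposable if it is nonzero and not the direct sum of two nonzero
submodules. -/
def IsIndecomposable (ρ : sl2 k →ₗ⁅k⁆ Module.End k M) : Prop :=
  Nontrivial M ∧ ∀ W W' : Submodule k M, (∀ a, ∀ w ∈ W, ρ a w ∈ W) →
    (∀ a, ∀ w ∈ W', ρ a w ∈ W') → IsCompl W W' → W = ⊥ ∨ W' = ⊥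

end Rep
/-- The restricted nullcone of `sl2` is the zero locus of `xy + z²`. -/
theorem pow_eq_zero_iff_nullcone {k : Type u} [Field k] {p : ℕ} (hp : 2 ≤ p) (a : sl2 k) :
    a.1 ^ p = 0 ↔ a.1 0 1 * a.1 1 0 + a.1 0 0 ^ 2 = 0 := by
  have htr : a.1 1 1 = - a.1 0 0 := by
    have hc : Matrix.trace a.1 = 0 := a.2
    rw [Matrix.trace_fin_two] at hc
    exact eq_neg_of_add_eq_zero_right hc
  have hsq : a.1 ^ 2 = (a.1 0 1 * a.1 1 0 + a.1 0 0 ^ 2) • (1 : Matrix (Fin 2) (Fin 2) k) := by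
    ext i j
    fin_cases i <;> fin_cases j <;>
      simp [pow_two, Matrix.mul_apply, Fin.sum_univ_two, htr] <;> ring
  constructor
  · intro h0
    have h1 : (a.1 ^ 2) ^ p = 0 := by rw [← pow_mul, mul_comm, pow_mul, h0, zero_pow two_ne_zero]
    rw [hsq, smul_pow, one_pow] at h1
    have h2 := congrFun (congrFun h1 0) 0
    simp only [Matrix.smul_apply, Matrix.one_apply_eq, smul_eq_mul, mul_one,
      Matrix.zero_apply] at h2
    exact eq_zero_of_pow_eq_zero h2
  · intro h0
    rw [h0, zero_smul] at hsq
    rw [← Nat.add_sub_of_le hp, pow_add, hsq, zero_mul]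

section Sheaves
attribute [local instance] LieRing.ofAssociativeRing MvPolynomial.gradedAlgebra
variable (k : Type u) [Field k]

/-- The homogeneous coordinate ring `k[s, t]` of the projective line, `s = X 0`, `t = X 1`. -/
abbrev coordRing : Type u := MvPolynomial (Fin 2) k

abbrev grading : ℕ → Submodule k (coordRing k) := homogeneousSubmodule (Fin 2) k

/-- The projective line `Proj k[s, t]`. -/
def P1 : Scheme.{u} := Proj (grading k)

/-- The coordinate ring `k[x, y, z] / (xy + z²)` of the restricted nullcone of `sl2`; here
`x, y, z` are the coordinates dual to `e, f, h`. -/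
abbrev nullconeRing : Type u :=
  MvPolynomial (Fin 3) k ⧸ Ideal.span {(X 0 * X 1 + X 2 ^ 2 : MvPolynomial (Fin 3) k)}

/-- The comorphism `x ↦ s², y ↦ -t², z ↦ st` of the isomorphism from the projective line to the
projectivized nullcone, `[s : t] ↦ [s² : -t² : st]`. It doubles degrees, so `𝒪(1)` on the
projectivized nullcone pulls back to `𝒪(2)`. -/
def iota : nullconeRing k →ₐ[k] coordRing k :=
  Ideal.Quotient.liftₐ _ (aeval ![X 0 ^ 2, - X 1 ^ 2, X 0 * X 1]) <| by
    intro a ha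
    have hle : Ideal.span {(X 0 * X 1 + X 2 ^ 2 : MvPolynomial (Fin 3) k)} ≤ RingHom.ker
        (aeval ![X 0 ^ 2, - X 1 ^ 2, X 0 * X 1] : MvPolynomial (Fin 3) k →ₐ[k] coordRing k) := by
      rw [Ideal.span_singleton_le_iff_mem, RingHom.mem_ker]
      simp; ring
    exact hle ha

/-- The coordinate `x`. -/
abbrev nx : nullconeRing k := Ideal.Quotient.mk _ (X 0)
/-- The coordinate `y`. -/
abbrev ny : nullconeRing k := Ideal.Quotient.mk _ (X 1)
/-- The coordinate `z`. -/
abbrev nz : nullconeRing k := Ideal.Quotient.mk _ (X 2)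

theorem iota_nx : iota k (nx k) = X 0 ^ 2 := by
  change aeval _ _ = _
  simp
theorem iota_ny : iota k (ny k) = - X 1 ^ 2 := by
  change aeval _ _ = _
  simp
theorem iota_nz : iota k (nz k) = X 0 * X 1 := by
  change aeval _ _ = _
  simp

/-- The degree `j` part of `k[s, t]` for an integer `j`; it is zero if `j < 0`. -/
def intGrading : ℤ → Submodule k (coordRing k)
  | .ofNat n => grading k n
  | .negSucc _ => ⊥

variable {k} in
theorem mul_mem_intGrading {i : ℕ} {j : ℤ} {a b : coordRing k} (ha : a ∈ grading k i)
    (hb : b ∈ intGrading k j) : a * b ∈ intGrading k (i + j) := by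
  cases j with
  | ofNat n => exact SetLike.GradedMul.mul_mem (A := grading k) ha hb
  | negSucc n =>
    rw [show b = 0 from hb, mul_zero]
    exact zero_mem _

/-- The graded module `k[s, t][n]`, whose degree `i` part is the degree `i + n` part of `k[s, t]`. -/
def twistMod (n : ℤ) : GradedMod (grading k) where
  carrier := coordRing k
  deg i := (intGrading k (i + n)).toAddSubgroup
  smul_mem {i j a m} ha hm := by
    rw [add_assoc]; exact mul_mem_intGrading ha hm

/-- The sheaf `𝒪(n)` on the projective line. -/
def O (n : ℤ) : (P1 k).Modules := tilde (twistMod k n)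

variable (M : Type u) [AddCommGroup M] [Module k M]

/-- The graded module `k[s, t][n] ⊗ M`. -/
def tensorMod (n : ℤ) : GradedMod (grading k) where
  carrier := coordRing k ⊗[k] M
  deg i := (LinearMap.range ((intGrading k (i + n)).subtype.rTensor M)).toAddSubgroup
  smul_mem {i j a m} ha hm := by
    obtain ⟨t, rfl⟩ := hm
    induction t with
    | zero => simp
    | add t t' h h' => rw [map_add, smul_add]; exact add_mem h h'
    | tmul b m =>
      refine ⟨⟨a * b.1, ?_⟩ ⊗ₜ m, rfl⟩
      rw [add_assoc]; exact mul_mem_intGrading ha b.2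

/-- The sheaf `𝒪(n) ⊗ M` on the projective line. -/
def tensorSheaf (n : ℤ) : (P1 k).Modules := tilde (tensorMod k M n)

variable {k M} (ρ : sl2 k →ₗ⁅k⁆ Module.End k M)

/-- The action of `x ⊗ e + y ⊗ f + z ⊗ h` on `k[s, t] ⊗ M`, the scalars being extended along
`iota`. -/
def theta : coordRing k ⊗[k] M →ₗ[coordRing k] coordRing k ⊗[k] M :=
  iota k (nx k) • (ρ (e k)).baseChange (coordRing k) +
  iota k (ny k) • (ρ (f k)).baseChange (coordRing k) +
  iota k (nz k) • (ρ (h k)).baseChange (coordRing k)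

theorem smul_baseChange_mem {c : coordRing k} (hc : c ∈ grading k 2) (T : Module.End k M)
    {n m : ℤ} (hm : m = n + 2) (i : ℤ) (v : coordRing k ⊗[k] M) (hv : v ∈ (tensorMod k M n).deg i) :
    c • T.baseChange (coordRing k) v ∈ (tensorMod k M m).deg i := by
  obtain ⟨t, rfl⟩ := hv
  induction t with
  | zero => rw [map_zero, map_zero, smul_zero]; exact zero_mem _
  | add t t' h h' => rw [map_add, map_add, smul_add]; exact add_mem h h'
  | tmul b w =>
    refine ⟨⟨c * b.1, ?_⟩ ⊗ₜ T w, rfl⟩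
    rw [show i + m = (2 : ℕ) + (i + n) by rw [hm]; push_cast; ring]
    exact mul_mem_intGrading hc b.2

theorem theta_mem {n m : ℤ} (hm : m = n + 2) (i : ℤ) (v : coordRing k ⊗[k] M)
    (hv : v ∈ (tensorMod k M n).deg i) : theta ρ v ∈ (tensorMod k M m).deg i := by
  have hs : ∀ j : Fin 2, (X j : coordRing k) ∈ grading k 1 := fun j => isHomogeneous_X k j
  refine add_mem (add_mem ?_ ?_) ?_
  · refine smul_baseChange_mem ?_ _ hm i v hv
    rw [iota_nx, pow_two]; exact SetLike.GradedMul.mul_mem (hs 0) (hs 0)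
  · refine smul_baseChange_mem ?_ _ hm i v hv
    rw [iota_ny, pow_two]; exact neg_mem (SetLike.GradedMul.mul_mem (hs 1) (hs 1))
  · refine smul_baseChange_mem ?_ _ hm i v hv
    rw [iota_nz]; exact SetLike.GradedMul.mul_mem (hs 0) (hs 1)

/-- The twist `Θ_M(n) : 𝒪(n) ⊗ M ⟶ 𝒪(n + 2) ⊗ M` of the global operator. -/
def globalOp (n m : ℤ) (hm : m = n + 2) : tensorSheaf k M n ⟶ tensorSheaf k M m :=
  tildeMap (theta ρ) (theta_mem ρ hm)

/-- The composite of `j` successive twists of the global operator, `𝒪(n) ⊗ M ⟶ 𝒪(n + 2j) ⊗ M`. -/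
def globalOpPow : (j : ℕ) → (n m : ℤ) → m = n + 2 * j → (tensorSheaf k M n ⟶ tensorSheaf k M m)
  | 0, _, _, hm => eqToHom (congrArg _ (by simp [hm]))
  | j + 1, n, m, hm => globalOp ρ n (n + 2) rfl ≫
      globalOpPow j (n + 2) m (by rw [hm]; push_cast; ring)

/-- The kernel of `Θ_M^j : 𝒪 ⊗ M ⟶ 𝒪(2j) ⊗ M`. -/
def gker (j : ℕ) : Subobject (tensorSheaf k M 0) :=
  kernelSubobject (globalOpPow ρ j 0 (2 * j) (zero_add _).symm)

/-- The image of `Θ_M^j : 𝒪(-2j) ⊗ M ⟶ 𝒪 ⊗ M`. -/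
def gim (j : ℕ) : Subobject (tensorSheaf k M 0) :=
  imageSubobject (globalOpPow ρ j (-(2 * j)) 0 (neg_add_cancel _).symm)

theorem imageSubobject_globalOpPow_succ_le (j : ℕ) (n n' m : ℤ) (hm : m = n + 2 * (j + 1 : ℕ))
    (hm' : m = n' + 2 * j) :
    imageSubobject (globalOpPow ρ (j + 1) n m hm) ≤ imageSubobject (globalOpPow ρ j n' m hm') := by
  obtain rfl : n' = n + 2 := by push_cast at hm; omega
  exact imageSubobject_comp_le _ _

theorem gim_le (i : ℕ) : gim ρ i ≤ gim ρ (i - 1) := by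
  cases i with
  | zero => exact le_rfl
  | succ j => exact imageSubobject_globalOpPow_succ_le ρ j _ _ _ _ _

/-- The sheaf `F_i(M) = (Ker Θ ∩ Im Θ^(i-1)) / (Ker Θ ∩ Im Θ^i)`, for `i ≥ 1`, as a sheaf of
modules on the projective line. -/
def sheafF (i : ℕ) : (P1 k).Modules :=
  cokernel (Subobject.ofLE (gker ρ 1 ⊓ gim ρ i) (gker ρ 1 ⊓ gim ρ (i - 1))
    (inf_le_inf le_rfl (gim_le ρ i)))

end Sheaves
end WeylSheaf
end

/-!
The operator `Θ = s² e - t² f + s t h` is, over each point of the projective line, the action of a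
nilpotent matrix of rank one with kernel and image spanned by `u = s x - t y`, where `x, y` is the
standard basis of `k²`. The Weyl module is the divided power `Γ^λ(k²)`, with
`v_m = x^(λ-m) y^(m)`. Where `s ≠ 0`, the elements `e_j = u^(λ-j) y^(j)` form a basis, and
`Θ e_{j+1} = s (λ - j) e_j`, `Θ e_0 = 0`; where `t ≠ 0` the same holds with `x` in place of `y` and
`t` in place of `s`. In both cases `e_0` is the same global element `w = u^(λ)`, of degree `λ`. Such
bases are recorded by `IsShiftFrame`.

The chain `e_λ → e_{λ-1} → ⋯ → e_0` breaks into Jordan blocks exactly below the `e_j` with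
`j ≡ λ + 1` modulo `p`. All blocks have size `p`, except for the one that contains `e_0`, whose size
is `λ mod p + 1`. Hence for `i < p` every `e_j` in the kernel with `j > 0` lies in the image of
`Θ^i`, and `e_0` does so if and only if `i ≤ λ mod p`, that is, if `p` does not divide the falling
factorial `λ (λ - 1) ⋯ (λ - i + 1)`. So nothing happens between step `i - 1` and step `i` unless
`i = λ mod p + 1`, and then the quotient is freely generated by the class of `w`, which gives
`𝒪(-λ)`. This argument applies to every `λ`, whether or not the Weyl module is indecomposable.

To pass from `k[s, t]`-modules to sheaves, kernel and images of `Θ` are described as subsheaves of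
`𝒪 ⊗ M` of sections that are locally fractions with numerator in a given submodule
(`gker_inf_gim_eq`); for the image this submodule is the saturation `satRange` of the range with
respect to `s` and `t`. The quotient is then compared with `𝒪(-λ)` by `nonempty_cokernel_ofLE_iso`,
which asks that `w` and the smaller subsheaf generate the larger one (`eq_zero_of_lineMap_comp`) and
that they meet in zero (`eq_zero_of_comp_lineMap`).
-/

noncomputable section
open CategoryTheory Limits TopologicalSpace Opposite AlgebraicGeometry TensorProduct

namespace ProjTilde
universe u
variable {k A : Type u} [Field k] [CommRing A] [Algebra k A]
  {𝒜 : ℕ → Submodule k A} [GradedAlgebra 𝒜]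

/-! ### Sections of the sheaf associated with a graded module -/

section Sections
variable {N N' N'' : GradedMod 𝒜} {U V : (Proj 𝒜).Opens}

/-- The value at the point `x` of a section of the sheaf associated with `N`. -/
def value (s : Γ(tilde N, U)) (x : U) : Fiber N x.1 := (show sections N U from s).1 x

theorem section_ext {s t : Γ(tilde N, U)} (hst : ∀ x, value s x = value t x) : s = t :=
  Subtype.ext (funext hst)

theorem value_app (φ : N.carrier →ₗ[A] N'.carrier)
    (hφ : ∀ (i : ℤ) (m : N.carrier), m ∈ N.deg i → φ m ∈ N'.deg i) (s : Γ(tilde N, U)) (x : U) :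
    value ((tildeMap φ hφ).app U s) x = fiberMap φ x.1 (value s x) := rfl

theorem value_map (i : V ⟶ U) (s : Γ(tilde N, U)) (x : V) :
    value ((tilde N).presheaf.map i.op s) x = value s ⟨x.1, i.le x.2⟩ := rfl

theorem value_zero (x : U) : value (0 : Γ(tilde N, U)) x = 0 := rfl

theorem value_add (s t : Γ(tilde N, U)) (x : U) : value (s + t) x = value s x + value t x := rfl

/-- The section `m / b` over an open set on which `b` does not vanish. -/
def fraction (N : GradedMod 𝒜) (U : (Proj 𝒜).Opens) {i : ℕ} {m : N.carrier} {b : A}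
    (hm : m ∈ N.deg i) (hb : b ∈ 𝒜 i)
    (hU : ∀ x ∈ U, b ∉ (ProjectiveSpectrum.asHomogeneousIdeal x).toIdeal) : Γ(tilde N, U) :=
  show sections N U from
    ⟨fun x => LocalizedModule.mk m ⟨b, hU x.1 x.2⟩, fun x => ⟨U, x.2, 𝟙 _, i, m, b, hm, hb,
      fun y => ⟨hU y.1 y.2, rfl⟩⟩⟩

theorem value_fraction {i : ℕ} {m : N.carrier} {b : A}
    (hm : m ∈ N.deg i) (hb : b ∈ 𝒜 i)
    (hU : ∀ x ∈ U, b ∉ (ProjectiveSpectrum.asHomogeneousIdeal x).toIdeal) (x : U) :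
    value (fraction N U hm hb hU) x = LocalizedModule.mk m ⟨b, hU x.1 x.2⟩ := rfl

theorem app_fraction (φ : N.carrier →ₗ[A] N'.carrier)
    (hφ : ∀ (i : ℤ) (m : N.carrier), m ∈ N.deg i → φ m ∈ N'.deg i) {i : ℕ} {m : N.carrier} {b : A}
    (hm : m ∈ N.deg i) (hb : b ∈ 𝒜 i)
    (hU : ∀ x ∈ U, b ∉ (ProjectiveSpectrum.asHomogeneousIdeal x).toIdeal) :
    (tildeMap φ hφ).app U (fraction N U hm hb hU) = fraction N' U (hφ _ _ hm) hb hU :=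
  section_ext fun x => by
    rw [value_app, value_fraction, value_fraction]
    exact LocalizedModule.map_mk _ φ m _

theorem fraction_add {i : ℕ} {m m' : N.carrier} {b : A}
    (hm : m ∈ N.deg i) (hm' : m' ∈ N.deg i) (hb : b ∈ 𝒜 i)
    (hU : ∀ x ∈ U, b ∉ (ProjectiveSpectrum.asHomogeneousIdeal x).toIdeal) :
    fraction N U (add_mem hm hm') hb hU = fraction N U hm hb hU + fraction N U hm' hb hU :=
  section_ext fun x => by
    rw [value_add, value_fraction, value_fraction, value_fraction, LocalizedModule.mk_add_mk,
      ← smul_add]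
    exact (LocalizedModule.mk_cancel_common_left _ _ _).symm

/-- Every section is a fraction near every point. -/
theorem exists_value_eq (s : Γ(tilde N, U)) (x : U) :
    ∃ V : (Proj 𝒜).Opens, x.1 ∈ V ∧ ∃ (i : V ⟶ U) (d : ℕ) (m : N.carrier) (b : A)
      (hm : m ∈ N.deg d) (hb : b ∈ 𝒜 d)
      (hV : ∀ x ∈ V, b ∉ (ProjectiveSpectrum.asHomogeneousIdeal x).toIdeal),
      (tilde N).presheaf.map i.op s = fraction N V hm hb hV := by
  obtain ⟨V, hV, i, d, m, b, hm, hb, w⟩ := (show sections N U from s).2 x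
  refine ⟨V, hV, i, d, m, b, hm, hb, fun y hy => (w ⟨y, hy⟩).1, section_ext fun y => ?_⟩
  exact (w y).2

end Sections

/-! ### Morphisms out of the sheaf associated with a graded module -/

section Hom
variable {N N' N'' : GradedMod 𝒜}

/-- Two morphisms out of the sheaf associated with `N` agree as soon as they agree on the fractions
`(c • m) / (c * b)`, where the factor `c` may be chosen depending on the point and on `m / b`. -/
theorem hom_ext_of_fraction {Z : (Proj 𝒜).Modules} {g h : tilde N ⟶ Z}
    (H : ∀ (x : Proj 𝒜) (i : ℕ) (m : N.carrier) (b : A), m ∈ N.deg i → b ∈ 𝒜 i →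
      ∃ (d : ℕ) (c : A), c ∉ (ProjectiveSpectrum.asHomogeneousIdeal x).toIdeal ∧ c ∈ 𝒜 d ∧
      ∀ (U : (Proj 𝒜).Opens) (hm : c • m ∈ N.deg (d + i : ℕ)) (hb : c * b ∈ 𝒜 (d + i))
        (hU : ∀ y ∈ U, c * b ∉ (ProjectiveSpectrum.asHomogeneousIdeal y).toIdeal),
        g.app U (fraction N U hm hb hU) = h.app U (fraction N U hm hb hU)) : g = h := by
  apply Scheme.Modules.hom_ext
  intro U
  ext s
  have key : ∀ x : U, ∃ V : (Proj 𝒜).Opens, x.1 ∈ V ∧ ∃ i : V ⟶ U,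
      g.app V ((tilde N).presheaf.map i.op s) = h.app V ((tilde N).presheaf.map i.op s) := by
    intro x
    obtain ⟨V, hxV, i, d, m, b, hm, hb, hV, e⟩ := exists_value_eq s x
    obtain ⟨n, c, hcx, hc, hgh⟩ := H x.1 d m b hm hb
    let W : (Proj 𝒜).Opens := V ⊓ ProjectiveSpectrum.basicOpen 𝒜 c
    have hW : W ≤ V := inf_le_left
    refine ⟨W, ⟨hxV, hcx⟩, homOfLE hW ≫ i, ?_⟩
    have hm' : c • m ∈ N.deg (n + d : ℕ) := by
      push_cast; exact N.smul_mem hc hm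
    have hb' : c * b ∈ 𝒜 (n + d) := SetLike.GradedMul.mul_mem hc hb
    have hW' : ∀ y ∈ W, c * b ∉ (ProjectiveSpectrum.asHomogeneousIdeal y).toIdeal :=
      fun y hy hcb => ((isPrime_top y).mem_or_mem hcb).elim hy.2 (hV y hy.1)
    have e' : (tilde N).presheaf.map (homOfLE hW ≫ i).op s = fraction N W hm' hb' hW' := by
      refine section_ext fun y => ?_
      have e1 : value ((tilde N).presheaf.map i.op s) ⟨y.1, y.2.1⟩ =
        value (fraction N V hm hb hV) ⟨y.1, y.2.1⟩ := by rw [e]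
      rw [value_map] at e1 ⊢
      rw [e1, value_fraction, value_fraction]
      exact (LocalizedModule.mk_cancel_common_left ⟨c, y.2.2⟩ ⟨b, hV y.1 y.2.1⟩ m).symm
    rw [e']
    exact hgh W hm' hb' hW'
  choose V hxV i hV using key
  refine TopCat.Sheaf.eq_of_locally_eq' ⟨Z.presheaf, Z.isSheaf⟩ V U i
    (fun x hx => Opens.mem_iSup.2 ⟨⟨x, hx⟩, hxV ⟨x, hx⟩⟩) _ _ fun x => ?_
  have n1 := ConcreteCategory.congr_hom (g.mapPresheaf.naturality (i x).op) s
  have n2 := ConcreteCategory.congr_hom (h.mapPresheaf.naturality (i x).op) s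
  exact (n1.symm.trans (hV x)).trans n2

theorem tildeMap_comp (φ : N.carrier →ₗ[A] N'.carrier)
    (hφ : ∀ (i : ℤ) (m : N.carrier), m ∈ N.deg i → φ m ∈ N'.deg i)
    (ψ : N'.carrier →ₗ[A] N''.carrier)
    (hψ : ∀ (i : ℤ) (m : N'.carrier), m ∈ N'.deg i → ψ m ∈ N''.deg i)
    (χ : N.carrier →ₗ[A] N''.carrier)
    (hχ : ∀ (i : ℤ) (m : N.carrier), m ∈ N.deg i → χ m ∈ N''.deg i)
    (h : ∀ (i : ℤ), ∀ m ∈ N.deg i, ψ (φ m) = χ m) :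
    tildeMap φ hφ ≫ tildeMap ψ hψ = tildeMap χ hχ := by
  refine hom_ext_of_fraction fun x i m b hm hb => ⟨0, 1, ?_, SetLike.GradedOne.one_mem,
    fun U hm hb hU => ?_⟩
  · exact (isPrime_top x).one_notMem
  · change (tildeMap ψ hψ).app U ((tildeMap φ hφ).app U _) = _
    rw [app_fraction, app_fraction, app_fraction]
    congr 1
    exact h _ _ hm

theorem tildeMap_id (hφ : ∀ (i : ℤ) (m : N.carrier), m ∈ N.deg i →
    (LinearMap.id : N.carrier →ₗ[A] N.carrier) m ∈ N.deg i) :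
    tildeMap LinearMap.id hφ = 𝟙 (tilde N) := by
  refine hom_ext_of_fraction fun x i m b hm hb => ⟨0, 1, ?_, SetLike.GradedOne.one_mem,
    fun U hm hb hU => ?_⟩
  · exact (isPrime_top x).one_notMem
  · rw [app_fraction]
    rfl

/-- If every homogeneous element of `N` is a sum `φ a + ψ b`, then the sheaf associated with `N` is
generated by the images of the morphisms induced by `φ` and `ψ`. -/
theorem eq_zero_of_tildeMap_comp_eq_zero
    {φ : N'.carrier →ₗ[A] N.carrier}
    {hφ : ∀ (i : ℤ) (m : N'.carrier), m ∈ N'.deg i → φ m ∈ N.deg i}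
    {ψ : N''.carrier →ₗ[A] N.carrier}
    {hψ : ∀ (i : ℤ) (m : N''.carrier), m ∈ N''.deg i → ψ m ∈ N.deg i}
    (H : ∀ (i : ℕ), ∀ m ∈ N.deg i, ∃ a ∈ N'.deg i, ∃ b ∈ N''.deg i, φ a + ψ b = m)
    {Z : (Proj 𝒜).Modules} {g : tilde N ⟶ Z}
    (h : tildeMap φ hφ ≫ g = 0) (h' : tildeMap ψ hψ ≫ g = 0) : g = 0 := by
  refine hom_ext_of_fraction fun x i m b _ _ => ⟨0, 1, (isPrime_top x).one_notMem,
    SetLike.GradedOne.one_mem, fun U hm hb hU => ?_⟩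
  generalize (1 : A) • m = m at hm
  obtain ⟨a, ha, a', ha', rfl⟩ := H _ m hm
  rw [fraction_add (hφ _ _ ha) (hψ _ _ ha'), map_add, ← app_fraction φ hφ ha,
    ← app_fraction ψ hψ ha']
  change (tildeMap φ hφ ≫ g).app U _ + (tildeMap ψ hψ ≫ g).app U _ = 0
  rw [h, h']
  exact add_zero _

theorem mono_of_injective {X : Scheme.{u}} {F G : X.Modules} (f : F ⟶ G)
    (hf : ∀ U, Function.Injective (f.app U)) : Mono f where
  right_cancellation g h e := by
    apply Scheme.Modules.hom_ext
    intro U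
    ext s
    refine hf U ?_
    change (g ≫ f).app U s = (h ≫ f).app U s
    rw [e]

end Hom

/-! ### Subsheaves given by submodules -/

section Restrict
variable (N : GradedMod 𝒜) (P Q : Submodule A N.carrier)

/-- The graded module with the same carrier as `N` whose homogeneous elements are those of `N` that
lie in `P`. Its associated sheaf is the subsheaf of those sections that are locally fractions with
numerator in `P`. -/
def GradedMod.restrict : GradedMod 𝒜 where
  carrier := N.carrier
  deg j := N.deg j ⊓ P.toAddSubgroup
  smul_mem ha hm := ⟨N.smul_mem ha hm.1, P.smul_mem _ hm.2⟩

/-- The inclusion of the subsheaf of fractions with numerator in `P`. -/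
def incl : tilde (N.restrict P) ⟶ tilde N :=
  tildeMap (N := N.restrict P) (N' := N) LinearMap.id fun _ _ hm => hm.1

variable {P Q} in
/-- The inclusion between two subsheaves of the sheaf associated with `N`. -/
def inclOfLE (h : P ≤ Q) : tilde (N.restrict P) ⟶ tilde (N.restrict Q) :=
  tildeMap (N := N.restrict P) (N' := N.restrict Q) LinearMap.id fun _ _ hm => ⟨hm.1, h hm.2⟩

variable {P Q} in
theorem inclOfLE_comp_incl (h : P ≤ Q) : inclOfLE N h ≫ incl N Q = incl N P :=
  tildeMap_comp _ _ _ _ _ _ fun _ _ _ => rfl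

theorem fiberMap_id (x : ProjectiveSpectrum.top 𝒜) (v : Fiber N x) :
    fiberMap (N := N) (N' := N) LinearMap.id x v = v := by
  induction v using LocalizedModule.induction_on with
  | h m b => exact LocalizedModule.map_mk _ _ m _

theorem value_incl {U : (Proj 𝒜).Opens} (s : Γ(tilde (N.restrict P), U)) (x : U) :
    value ((incl N P).app U s) x = value s x :=
  fiberMap_id N x.1 (value s x)

instance mono_incl : Mono (incl N P) :=
  mono_of_injective _ fun U s t e => section_ext fun x => by
    have := congrArg (fun s => value s x) e
    rwa [value_incl, value_incl] at this

/-- A morphism to the sheaf associated with `N` factors through the subsheaf of fractions with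
numerator in `P` if all its values are fractions with numerator in `P`, locally. -/
theorem exists_comp_incl_eq {X : (Proj 𝒜).Modules} (f : X ⟶ tilde N)
    (hf : ∀ U (z : Γ(X, U)), (show sections N U from f.app U z).1 ∈ sections (N.restrict P) U) :
    ∃ g, g ≫ incl N P = f := by
  let g : X ⟶ tilde (N.restrict P) :=
    { val := PresheafOfModules.homMk
        { app := fun U => AddCommGrpCat.ofHom
            { toFun := fun z => (⟨_, hf U.unop z⟩ : sections (N.restrict P) U.unop)
              map_zero' := Subtype.ext <|
                congrArg (Subtype.val : sections N U.unop → _) (map_zero (f.app U.unop).hom)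
              map_add' := fun s t => Subtype.ext <| congrArg (Subtype.val : sections N U.unop → _)
                  (map_add (f.app U.unop).hom s t) }
          naturality := fun U V i => by
            ext z
            exact Subtype.ext <| congrArg (Subtype.val : sections N V.unop → _) <|
              ConcreteCategory.congr_hom (f.mapPresheaf.naturality i) z }
        (fun U r s => Subtype.ext <| congrArg (Subtype.val : sections N U.unop → _)
          (f.app_smul (U := U.unop) r s)) }
  refine ⟨g, ?_⟩
  apply Scheme.Modules.hom_ext
  intro U
  ext z
  exact section_ext fun x => value_incl N P _ x

variable {P} in
/-- A section lies in the subsheaf of fractions with numerator in `P` if, near every point, it is a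
fraction `m / b` with `m` in `P`, where `m` may first be multiplied by any homogeneous
`c` that does not vanish at the point. -/
theorem mem_sections_restrict {U : (Proj 𝒜).Opens} (s : Γ(tilde N, U))
    (hs : ∀ (x : U) (V : (Proj 𝒜).Opens) (_ : x.1 ∈ V) (i : V ⟶ U) (d : ℕ) (m : N.carrier) (b : A)
      (hm : m ∈ N.deg d) (hb : b ∈ 𝒜 d)
      (hV : ∀ x ∈ V, b ∉ (ProjectiveSpectrum.asHomogeneousIdeal x).toIdeal),
      (tilde N).presheaf.map i.op s = fraction N V hm hb hV →
      ∃ (n : ℕ) (c : A), c ∈ 𝒜 n ∧ c ∉ (ProjectiveSpectrum.asHomogeneousIdeal x.1).toIdeal ∧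
        c • m ∈ P) :
    (show sections N U from s).1 ∈ sections (N.restrict P) U := by
  intro x
  obtain ⟨V, hxV, i, d, m, b, hm, hb, hV, e⟩ := exists_value_eq s x
  obtain ⟨n, c, hc, hcx, hcm⟩ := hs x V hxV i d m b hm hb hV e
  have hle : V ⊓ ProjectiveSpectrum.basicOpen 𝒜 c ≤ V := inf_le_left
  refine ⟨V ⊓ ProjectiveSpectrum.basicOpen 𝒜 c, ⟨hxV, hcx⟩, homOfLE hle ≫ i,
    n + d, c • m, c * b, ⟨?_, hcm⟩, SetLike.GradedMul.mul_mem hc hb, fun y => ?_⟩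
  · push_cast
    exact N.smul_mem hc hm
  · refine ⟨fun hcb => ((isPrime_top y.1).mem_or_mem hcb).elim y.2.2 (hV y.1 y.2.1), ?_⟩
    have e1 : value ((tilde N).presheaf.map i.op s) ⟨y.1, y.2.1⟩ =
      value (fraction N V hm hb hV) ⟨y.1, y.2.1⟩ := by rw [e]
    rw [value_map, value_fraction] at e1
    exact e1.trans
      (LocalizedModule.mk_cancel_common_left ⟨c, y.2.2⟩ ⟨b, hV y.1 y.2.1⟩ m).symm

end Restrict

/-! ### Kernels and intersections over a domain -/

section TorsionFree
variable [IsDomain A] (N : GradedMod 𝒜)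

theorem smul_eq_smul_of_mk_eq {N : GradedMod 𝒜} [Module.IsTorsionFree A N.carrier]
    {x : ProjectiveSpectrum.top 𝒜} {m m' : N.carrier}
    {b b' : x.asHomogeneousIdeal.toIdeal.primeCompl}
    (h : (LocalizedModule.mk m b : Fiber N x) = LocalizedModule.mk m' b') :
    b'.1 • m = b.1 • m' := by
  obtain ⟨u, hu⟩ := LocalizedModule.mk_eq.1 h
  have hu0 : u.1 ≠ 0 := fun h0 => u.2 (h0 ▸ zero_mem _)
  exact smul_right_injective N.carrier hu0 hu

theorem kernelSubobject_tildeMap (N' : GradedMod 𝒜) [Module.IsTorsionFree A N'.carrier]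
    (φ : N.carrier →ₗ[A] N'.carrier)
    (hφ : ∀ (i : ℤ) (m : N.carrier), m ∈ N.deg i → φ m ∈ N'.deg i) :
    kernelSubobject (tildeMap φ hφ) = Subobject.mk (incl N (LinearMap.ker φ)) := by
  apply le_antisymm
  · obtain ⟨g, hg⟩ := exists_comp_incl_eq N (LinearMap.ker φ)
      (kernelSubobject (tildeMap φ hφ)).arrow fun U z => by
        refine mem_sections_restrict N _ fun x V hxV i d m b hm hb hV e =>
          ⟨0, 1, SetLike.GradedOne.one_mem, (isPrime_top x.1).one_notMem, ?_⟩
        rw [one_smul, LinearMap.mem_ker]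
        have e1 : value ((tilde N).presheaf.map i.op
          ((kernelSubobject (tildeMap φ hφ)).arrow.app U z)) ⟨x.1, hxV⟩ =
            value (fraction N V hm hb hV) ⟨x.1, hxV⟩ := by rw [e]
        rw [value_map, value_fraction] at e1
        have e2 : value ((tildeMap φ hφ).app U ((kernelSubobject (tildeMap φ hφ)).arrow.app U z)) x
            = 0 := by
          change value (((kernelSubobject (tildeMap φ hφ)).arrow ≫ tildeMap φ hφ).app U z) x = 0
          rw [kernelSubobject_arrow_comp]
          rfl
        rw [value_app, e1] at e2
        have e3 : (LocalizedModule.mk (φ m) ⟨b, hV x.1 hxV⟩ : Fiber N' x.1) =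
            LocalizedModule.mk 0 1 :=
          ((LocalizedModule.map_mk _ φ m _).symm.trans e2).trans (LocalizedModule.zero_mk _).symm
        have := smul_eq_smul_of_mk_eq e3
        rwa [smul_zero, Submonoid.coe_one, one_smul] at this
    exact Subobject.le_mk_of_comm g hg
  · refine le_kernelSubobject _ _ ?_
    rw [← cancel_epi (Subobject.underlyingIso (incl N (LinearMap.ker φ))).inv, comp_zero,
      ← Category.assoc, Subobject.underlyingIso_arrow]
    refine hom_ext_of_fraction fun x i m b _ _ => ⟨0, 1, (isPrime_top x).one_notMem,
      SetLike.GradedOne.one_mem, fun U hm hb hU => ?_⟩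
    change (tildeMap φ hφ).app U ((incl N (LinearMap.ker φ)).app U _) = 0
    refine (congrArg _ (app_fraction _ _ hm hb hU)).trans
      ((app_fraction (N := N) φ hφ hm.1 hb hU).trans (section_ext fun y => ?_))
    rw [value_fraction, value_zero]
    have h0 : φ ((1 : A) • m) = 0 := hm.2
    exact (congrArg (fun v => LocalizedModule.mk v _) h0).trans (LocalizedModule.zero_mk _)

/-- If `m / b = m₁ / b₁ = m₂ / b₂` with `m₁` in `P` and `m₂` in `Q`, then `(b₁ b₂) • m` lies in both
`P` and `Q`. -/
theorem mk_incl_inf [Module.IsTorsionFree A N.carrier] (P Q : Submodule A N.carrier) :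
    Subobject.mk (incl N P) ⊓ Subobject.mk (incl N Q) = Subobject.mk (incl N (P ⊓ Q)) := by
  apply le_antisymm
  · obtain ⟨g, hg⟩ := exists_comp_incl_eq N (P ⊓ Q)
      (Subobject.mk (incl N P) ⊓ Subobject.mk (incl N Q)).arrow fun U z => by
        let R := Subobject.mk (incl N P) ⊓ Subobject.mk (incl N Q)
        have hR : ∀ P', R ≤ Subobject.mk (incl N P') →
            ∃ f : (R : (Proj 𝒜).Modules) ⟶ tilde (N.restrict P'), f ≫ incl N P' = R.arrow :=
          fun P' h => ⟨Subobject.ofLE _ _ h ≫ (Subobject.underlyingIso _).hom, by simp⟩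
        obtain ⟨f₁, hf₁⟩ := hR P inf_le_left
        obtain ⟨f₂, hf₂⟩ := hR Q inf_le_right
        have hval : ∀ (P' : Submodule A N.carrier)
            (f : (R : (Proj 𝒜).Modules) ⟶ tilde (N.restrict P')), f ≫ incl N P' = R.arrow →
            ∀ x : U, value (R.arrow.app U z) x = value (f.app U z) x := fun P' f hf x => by
          rw [← hf]
          exact value_incl N P' _ x
        refine mem_sections_restrict N _ fun x V hxV i d m b hm hb hV e => ?_
        obtain ⟨V₁, hxV₁, i₁, d₁, m₁, b₁, hm₁, hb₁, hV₁, e₁⟩ := exists_value_eq (f₁.app U z) x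
        obtain ⟨V₂, hxV₂, i₂, d₂, m₂, b₂, hm₂, hb₂, hV₂, e₂⟩ := exists_value_eq (f₂.app U z) x
        have e0 : value ((tilde N).presheaf.map i.op (R.arrow.app U z)) ⟨x.1, hxV⟩ =
          value (fraction N V hm hb hV) ⟨x.1, hxV⟩ := congrArg (fun s => value s _) e
        have e1 := congrArg (fun s => value s ⟨x.1, hxV₁⟩) e₁
        have e2 := congrArg (fun s => value s ⟨x.1, hxV₂⟩) e₂
        rw [value_map, value_fraction] at e0
        simp only [value_map, value_fraction] at e1 e2
        rw [hval P f₁ hf₁] at e0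
        have q1 := smul_eq_smul_of_mk_eq (N := N) (e0.symm.trans e1)
        rw [← hval P f₁ hf₁, hval Q f₂ hf₂] at e0
        have q2 := smul_eq_smul_of_mk_eq (N := N) (e0.symm.trans e2)
        refine ⟨d₁ + d₂, b₁ * b₂, SetLike.GradedMul.mul_mem hb₁ hb₂,
          fun h => ((isPrime_top x.1).mem_or_mem h).elim (hV₁ _ hxV₁) (hV₂ _ hxV₂), ?_, ?_⟩
        · rw [mul_comm, mul_smul]
          have : b₁ • m = b • (m₁ : N.carrier) := q1
          rw [this]
          exact P.smul_mem _ (P.smul_mem _ hm₁.2)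
        · rw [mul_smul]
          have : b₂ • m = b • (m₂ : N.carrier) := q2
          rw [this]
          exact Q.smul_mem _ (Q.smul_mem _ hm₂.2)
    exact Subobject.le_mk_of_comm g hg
  · exact le_inf (Subobject.mk_le_mk_of_comm _ (inclOfLE_comp_incl N inf_le_left))
      (Subobject.mk_le_mk_of_comm _ (inclOfLE_comp_incl N inf_le_right))

/-- If `φ m₁ / b₁ = ψ m₂ / b₂` forces `m₁ = 0`, then the sheaf associated with `N₁` meets the one
associated with `N₂` in zero. -/
theorem eq_zero_of_comp_tildeMap_eq {N₁ N₂ : GradedMod 𝒜} [Module.IsTorsionFree A N.carrier]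
    {φ : N₁.carrier →ₗ[A] N.carrier}
    {hφ : ∀ (i : ℤ) (m : N₁.carrier), m ∈ N₁.deg i → φ m ∈ N.deg i}
    {ψ : N₂.carrier →ₗ[A] N.carrier}
    {hψ : ∀ (i : ℤ) (m : N₂.carrier), m ∈ N₂.deg i → ψ m ∈ N.deg i}
    (H : ∀ (j : ℤ) (m₁ : N₁.carrier), ∀ m₂ ∈ N₂.deg j, ∀ b₁ b₂ : A, b₂ ≠ 0 →
      b₂ • φ m₁ = b₁ • ψ m₂ → m₁ = 0)
    {Z : (Proj 𝒜).Modules} {g : Z ⟶ tilde N₁} {g' : Z ⟶ tilde N₂}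
    (h : g ≫ tildeMap φ hφ = g' ≫ tildeMap ψ hψ) : g = 0 := by
  apply Scheme.Modules.hom_ext
  intro U
  ext z
  refine section_ext fun x => ?_
  obtain ⟨V₁, hxV₁, i₁, d₁, m₁, b₁, hm₁, hb₁, hV₁, e₁⟩ := exists_value_eq (g.app U z) x
  obtain ⟨V₂, hxV₂, i₂, d₂, m₂, b₂, hm₂, hb₂, hV₂, e₂⟩ := exists_value_eq (g'.app U z) x
  have q1 : value (g.app U z) x = LocalizedModule.mk m₁ ⟨b₁, hV₁ _ hxV₁⟩ :=
    congrArg (fun s => value s ⟨x.1, hxV₁⟩) e₁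
  have q2 : value (g'.app U z) x = LocalizedModule.mk m₂ ⟨b₂, hV₂ _ hxV₂⟩ :=
    congrArg (fun s => value s ⟨x.1, hxV₂⟩) e₂
  have q3 : value ((tildeMap φ hφ).app U (g.app U z)) x =
      value ((tildeMap ψ hψ).app U (g'.app U z)) x := by
    change value ((g ≫ tildeMap φ hφ).app U z) x = value ((g' ≫ tildeMap ψ hψ).app U z) x
    rw [h]
  rw [value_app, value_app, q1, q2] at q3
  have q4 := smul_eq_smul_of_mk_eq (((LocalizedModule.map_mk _ φ m₁ _).symm.trans q3).trans
    (LocalizedModule.map_mk _ ψ m₂ _))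
  rw [q1, H d₂ m₁ m₂ hm₂ b₁ b₂ (fun h0 => hV₂ _ hxV₂ (h0 ▸ zero_mem _)) q4]
  exact LocalizedModule.zero_mk _

end TorsionFree

/-! ### Images -/

section Image

/-- The image of the morphism induced by `φ` is the subsheaf of fractions with numerator in `P`, if
`P` contains the range of `φ` and the homogeneous elements of `P` are images of homogeneous elements
locally, up to a factor. -/
theorem imageSubobject_tildeMap (N N' : GradedMod 𝒜) (P : Submodule A N'.carrier)
    (φ : N.carrier →ₗ[A] N'.carrier)
    (hφ : ∀ (i : ℤ) (m : N.carrier), m ∈ N.deg i → φ m ∈ N'.deg i)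
    (hφP : ∀ m, φ m ∈ P)
    (hP : ∀ (x : Proj 𝒜) (i : ℕ), ∀ m ∈ N'.deg i, m ∈ P → ∃ (d : ℕ) (c : A),
      c ∉ (ProjectiveSpectrum.asHomogeneousIdeal x).toIdeal ∧ c ∈ 𝒜 d ∧
        ∃ m' ∈ N.deg (d + i : ℕ), φ m' = c • m) :
    imageSubobject (tildeMap φ hφ) = Subobject.mk (incl N' P) := by
  let e : tilde N ⟶ tilde (N'.restrict P) :=
    tildeMap (N := N) (N' := N'.restrict P) φ fun i m hm => ⟨hφ i m hm, hφP m⟩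
  have he : e ≫ incl N' P = tildeMap φ hφ := tildeMap_comp _ _ _ _ _ _ fun _ _ _ => rfl
  have : Epi e := by
    refine ⟨fun {Z} g h hgh => hom_ext_of_fraction fun x i m b hm hb => ?_⟩
    obtain ⟨d, c, hcx, hc, m', hm', hmm'⟩ := hP x i m hm.1 hm.2
    refine ⟨d, c, hcx, hc, fun U hcm hcb hU => ?_⟩
    have e1 : fraction (N'.restrict P) U hcm hcb hU =
        e.app U (fraction N U hm' hcb hU) := by
      refine Eq.trans ?_
        (app_fraction (N := N) (N' := N'.restrict P) φ _ hm' hcb hU).symm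
      congr 1
      exact hmm'.symm
    rw [e1]
    change (e ≫ g).app U _ = (e ≫ h).app U _
    rw [hgh]
  apply le_antisymm
  · exact imageSubobject_le_mk _ _ e he
  · have hle := imageSubobject_comp_le e (incl N' P)
    have := isIso_of_mono_of_epi (Subobject.ofLE _ _ hle)
    rw [← imageSubobject_mono, ← he]
    exact (Subobject.eq_of_comm (asIso (Subobject.ofLE _ _ hle)) (by simp)).ge

end Image
end ProjTilde

namespace WeylSheaf
universe u
open MvPolynomial ProjTilde

/-! ### Weighted shifts and frames -/

section Shift
variable {S : Type*} [CommRing S]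

/-- The weighted shift `(D α)_j = c (λ - j) α_{j+1}` on sequences. -/
def shift (lam : ℕ) (c : S) : (ℕ → S) →ₗ[S] (ℕ → S) where
  toFun α j := c * (lam - j) * α (j + 1)
  map_add' α β := by ext j; simp [mul_add]
  map_smul' r α := by ext j; simp [mul_left_comm]

theorem shift_apply (lam : ℕ) (c : S) (α : ℕ → S) (j : ℕ) :
    shift lam c α j = c * (lam - j) * α (j + 1) := rfl

theorem shift_pow_apply (lam : ℕ) (c : S) (i : ℕ) (α : ℕ → S) (j : ℕ) :
    (shift lam c ^ i) α j = c ^ i * (∏ l ∈ Finset.range i, ((lam : S) - j - l)) * α (j + i) := by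
  induction i generalizing α with
  | zero => simp
  | succ i ih =>
    rw [pow_succ, Module.End.mul_apply, ih, shift_apply, Finset.prod_range_succ]
    push_cast
    rw [show j + i + 1 = j + (i + 1) by ring]
    ring

theorem shift_pow_apply_zero (lam : ℕ) (c : S) (i : ℕ) (α : ℕ → S) :
    (shift lam c ^ i) α 0 = c ^ i * (lam.descFactorial i : S) * α i := by
  rw [shift_pow_apply, ← descPochhammer_eval_eq_descFactorial, descPochhammer_eval_eq_prod_range]
  simp

variable {V : Type*} [AddCommGroup V] [Module S V]

/-- A frame for `θ` away from `c = 0`: vectors `e_j = F (δ_j)`, `0 ≤ j ≤ λ`, that are linearly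
independent, span `V` after inverting `c`, satisfy `θ e_{j+1} = c (λ - j) e_j` and `θ e_0 = 0`, and
begin with `e_0 = w`. Coordinates with index `> λ` are ignored by `F`. -/
structure IsShiftFrame (θ : Module.End S V) (lam : ℕ) (c : S) (w : V) (F : (ℕ → S) →ₗ[S] V) :
    Prop where
  map_shift : ∀ α, F (shift lam c α) = θ (F α)
  exists_eq : ∃ n : ℕ, ∀ v, ∃ α, c ^ n • v = F α
  eq_zero_iff : ∀ α, F α = 0 ↔ ∀ j ≤ lam, α j = 0
  map_single : F (Pi.single 0 1) = w

namespace IsShiftFrame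
variable {θ : Module.End S V} {lam : ℕ} {c : S} {w : V} {F : (ℕ → S) →ₗ[S] V}

theorem map_shift_pow (h : IsShiftFrame θ lam c w F) (i : ℕ) (α : ℕ → S) :
    F ((shift lam c ^ i) α) = (θ ^ i) (F α) := by
  induction i generalizing α with
  | zero => rfl
  | succ i ih =>
    rw [pow_succ, pow_succ, Module.End.mul_apply, Module.End.mul_apply, ih, h.map_shift]

theorem congr (h : IsShiftFrame θ lam c w F) {α β : ℕ → S} :
    F α = F β ↔ ∀ j ≤ lam, α j = β j := by
  rw [← sub_eq_zero, ← map_sub, h.eq_zero_iff]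
  simp only [Pi.sub_apply, sub_eq_zero]

theorem smul_eq_map (h : IsShiftFrame θ lam c w F) (x : S) : x • w = F (Pi.single 0 x) := by
  rw [← h.map_single, ← map_smul, ← Pi.single_smul, smul_eq_mul, mul_one]

theorem apply_eq_zero (h : IsShiftFrame θ lam c w F) : θ w = 0 := by
  rw [← h.map_single, ← h.map_shift, h.eq_zero_iff]
  intro j _
  simp [shift_apply]

variable {p : ℕ} [CharP S p]

/-- If the falling factorial `λ (λ - 1) ⋯ (λ - i + 1)` does not vanish, then `e_0` is, up to a
factor, the image of `e_i` under `θ ^ i`. -/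
theorem exists_pow_smul_eq [Fact p.Prime] (h : IsShiftFrame θ lam c w F) {i : ℕ}
    (hi : ¬ p ∣ lam.descFactorial i) : ∃ (n : ℕ) (v : V), c ^ n • w = (θ ^ i) v := by
  obtain ⟨u, hu⟩ := (CharP.isUnit_natCast_iff (R := S) Fact.out).2 hi
  refine ⟨i, F (Pi.single i (↑u⁻¹ : S)), ?_⟩
  rw [← h.map_shift_pow, h.smul_eq_map, h.congr]
  intro j _
  rcases Nat.eq_zero_or_pos j with rfl | hj
  · rw [shift_pow_apply_zero, ← hu]
    simp
  · rw [shift_pow_apply, Pi.single_eq_of_ne (by omega), Pi.single_eq_of_ne (by omega), mul_zero]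

variable [IsDomain S]

theorem eq_zero_of_smul_eq (h : IsShiftFrame θ lam c w F) (hc : c ≠ 0) {i : ℕ}
    (hi : p ∣ lam.descFactorial i) {x : S} {v : V} (hv : x • w = (θ ^ i) v) : x = 0 := by
  obtain ⟨n, hn⟩ := h.exists_eq
  obtain ⟨α, hα⟩ := hn v
  have e : F (Pi.single 0 (c ^ n * x)) = F ((shift lam c ^ i) α) := by
    rw [h.map_shift_pow, ← hα, map_smul, ← hv, smul_smul, h.smul_eq_map]
  have e0 := h.congr.1 e 0 (Nat.zero_le _)
  rw [shift_pow_apply_zero, (CharP.cast_eq_zero_iff S p _).2 hi, Pi.single_eq_same, mul_zero,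
    zero_mul] at e0
  exact (mul_eq_zero.1 e0).resolve_left (pow_ne_zero _ hc)

/-- An element of the kernel of `θ` has nonzero coordinates only at `0` and at the `j` with
`j ≡ λ + 1` modulo `p`. For `i < p` the basis vectors of the latter kind are, up to a factor, images
under `θ ^ i`. -/
theorem exists_pow_smul_eq_add [Fact p.Prime] (h : IsShiftFrame θ lam c w F) (hc : c ≠ 0)
    {i : ℕ} (hip : i < p)
    {v : V} (hv : θ v = 0) :
    ∃ (n : ℕ) (x : S) (v' : V), c ^ n • v = x • w + (θ ^ i) v' := by
  obtain ⟨n, hn⟩ := h.exists_eq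
  obtain ⟨α, hα⟩ := hn v
  have hD : ∀ j ≤ lam, c * ((lam : S) - j) * α (j + 1) = 0 := by
    rw [← h.eq_zero_iff (fun j => c * ((lam : S) - j) * α (j + 1))]
    change F (shift lam c α) = 0
    rw [h.map_shift, ← hα, map_smul, hv, smul_zero]
  have hfac : ¬ p ∣ i.factorial := fun hd =>
    absurd ((Nat.Prime.dvd_factorial Fact.out).1 hd) (not_le.2 hip)
  have hunit : IsUnit ((-1 : S) ^ i * (i.factorial : S)) :=
    (isUnit_one.neg.pow i).mul ((CharP.isUnit_natCast_iff (R := S) Fact.out).2 hfac)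
  obtain ⟨u, hu⟩ := hunit
  -- For `j ≡ λ + 1` the product in `shift_pow_apply` is `(-1) (-2) ⋯ (-i)`.
  have hprod : ∀ q : ℕ, ∏ l ∈ Finset.range q, (-1 - (l : S)) = (-1) ^ q * (q.factorial : S) := by
    intro q
    induction q with
    | zero => simp
    | succ q ih =>
      rw [Finset.prod_range_succ, ih, Nat.factorial_succ]
      push_cast
      ring
  refine ⟨i + n, c ^ i * α 0, F fun m => if i < m then (↑u⁻¹ : S) * α (m - i) else 0, ?_⟩
  rw [pow_add, mul_smul, hα, ← h.map_shift_pow, h.smul_eq_map, ← map_add, ← map_smul, h.congr]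
  intro j hj
  rw [Pi.add_apply, Pi.smul_apply, smul_eq_mul, shift_pow_apply]
  rcases Nat.eq_zero_or_pos j with rfl | hj0
  · simp
  · rw [Pi.single_eq_of_ne (by omega), zero_add, if_pos (by omega), Nat.add_sub_cancel]
    by_cases hα0 : α j = 0
    · rw [hα0]; ring
    · have h1 := hD (j - 1) (by omega)
      rw [Nat.sub_add_cancel hj0, Nat.cast_sub hj0] at h1
      have h2 : (lam : S) - j = -1 := by
        have h3 := (mul_eq_zero.1 ((mul_eq_zero.1 h1).resolve_right hα0)).resolve_left hc
        push_cast at h3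
        linear_combination h3
      rw [h2, hprod, ← hu, mul_assoc, Units.mul_inv_cancel_left]

/-- The term `x • w` in `exists_pow_smul_eq_add` vanishes if `v` is, up to a factor, in the image of
`θ ^ q` for some `q ≤ i` and `e_0` is not. -/
theorem eq_zero_of_dvd (h : IsShiftFrame θ lam c w F) (hc : c ≠ 0) {i q : ℕ}
    (hq : p ∣ lam.descFactorial q) (hqi : q ≤ i) {v v' v'' : V} {m n : ℕ} {x : S}
    (hv : c ^ m • v = (θ ^ q) v'') (hx : c ^ n • v = x • w + (θ ^ i) v') : x = 0 := by
  have e : (c ^ m * x) • w = (θ ^ q) (c ^ n • v'' - c ^ m • (θ ^ (i - q)) v') := by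
    rw [map_sub, map_smul, map_smul, ← hv, ← Module.End.mul_apply, ← pow_add,
      Nat.add_sub_of_le hqi, eq_sub_iff_add_eq, mul_smul, ← smul_add, ← hx, smul_comm]
  exact (mul_eq_zero.1 (h.eq_zero_of_smul_eq hc hq e)).resolve_left (pow_ne_zero _ hc)

end IsShiftFrame
end Shift

/-! ### Divisibility of falling factorials -/

theorem prime_dvd_descFactorial_iff {p : ℕ} (hp : p.Prime) {n i : ℕ} :
    p ∣ n.descFactorial i ↔ n % p < i := by
  rw [Nat.descFactorial_eq_prod_range, hp.prime.dvd_finsetProd_iff]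
  have hn := Nat.mod_add_div n p
  constructor
  · rintro ⟨l, hl, hd⟩
    rw [Finset.mem_range] at hl
    by_contra! hlt
    have : n - l = (n % p - l) + p * (n / p) := by omega
    rw [this, Nat.dvd_add_left (dvd_mul_right _ _)] at hd
    have := Nat.le_of_dvd (by omega) hd
    have := Nat.mod_lt n hp.pos
    omega
  · intro h
    refine ⟨n % p, Finset.mem_range.2 h, ?_⟩
    rw [show n - n % p = p * (n / p) by omega]
    exact dvd_mul_right _ _

/-! ### Frames of divided powers in coordinates -/

section Frame
variable {S : Type*} [CommRing S]

/-- The `m`-th coordinate of the `j`-th vector of the triangular frame: for `a = s`, `b = -t` this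
is the coordinate along `x^(λ-m) y^(m)` of the product of divided powers
`(a x + b y)^(λ-j) y^(j)`. The truncated exponent `m - j` is harmless, as the binomial coefficient
vanishes for `m < j`. -/
def frameCoeff (lam : ℕ) (a b : S) (j m : ℕ) : S := m.choose j * a ^ (lam - m) * b ^ (m - j)

/-- The operator `a² e - b² f - a b h` on the Weyl module, in coordinates. The terms outside the
range of indices, `g (m - 1)` for `m = 0` and `g (m + 1)` for `m = λ`, have coefficient zero. -/
def rankOneOp (lam : ℕ) (a b : S) (g : ℕ → S) (m : ℕ) : S :=
  a ^ 2 * (lam - m) * g (m + 1) - b ^ 2 * m * g (m - 1) - a * b * (lam - 2 * m) * g m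

theorem rankOneOp_frameCoeff_zero (lam : ℕ) (a b : S) {m : ℕ} (hm : m ≤ lam) :
    rankOneOp lam a b (frameCoeff lam a b 0) m = 0 := by
  simp only [rankOneOp, frameCoeff, Nat.choose_zero_right, Nat.cast_one, one_mul, Nat.sub_zero]
  obtain ⟨d, rfl⟩ := Nat.exists_eq_add_of_le hm
  rcases m with _ | m <;> rcases d with _ | d
  · simp
  · simp only [show 0 + (d + 1) - (0 + 1) = d by omega, show 0 + (d + 1) - 0 = d + 1 by omega]
    push_cast
    ring
  · simp only [show m + 1 + 0 - m = 1 by omega, show m + 1 + 0 - (m + 1) = 0 by omega,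
      show m + 1 - 1 = m by omega]
    push_cast
    ring
  · simp only [show m + 1 + (d + 1) - (m + 1 + 1) = d by omega,
      show m + 1 + (d + 1) - m = d + 2 by omega,
      show m + 1 + (d + 1) - (m + 1) = d + 1 by omega, show m + 1 - 1 = m by omega]
    push_cast
    ring

/-- The operator lowers the index of a frame vector. Up to powers of `a` and `b` this is an identity
between binomial coefficients, which follows from the Pascal and absorption identities. -/
theorem rankOneOp_frameCoeff_succ (lam : ℕ) (a b : S) {j m : ℕ} (hm : m ≤ lam) :
    rankOneOp lam a b (frameCoeff lam a b (j + 1)) m =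
      a * (lam - j) * frameCoeff lam a b j m := by
  simp only [rankOneOp, frameCoeff]
  obtain ⟨d, rfl⟩ := Nat.exists_eq_add_of_le hm
  rcases lt_trichotomy m j with h | rfl | h
  · rw [Nat.choose_eq_zero_of_lt (by omega : m + 1 < j + 1),
      Nat.choose_eq_zero_of_lt (by omega : m - 1 < j + 1),
      Nat.choose_eq_zero_of_lt (by omega : m < j + 1), Nat.choose_eq_zero_of_lt h]
    simp
  · rw [Nat.choose_eq_zero_of_lt (by omega : m - 1 < m + 1),
      Nat.choose_eq_zero_of_lt (by omega : m < m + 1), Nat.choose_self, Nat.choose_self]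
    rcases d with _ | d
    · simp
    · simp only [show m + (d + 1) - (m + 1) = d by omega, show m + (d + 1) - m = d + 1 by omega,
        Nat.sub_self]
      push_cast
      ring
  · obtain ⟨q, rfl⟩ := Nat.exists_eq_add_of_lt h
    have c1 : ((j + q + 1 + 1).choose (j + 1) : S) =
        (j + q + 1).choose j + (j + q + 1).choose (j + 1) := by
      rw [Nat.choose_succ_succ]; push_cast; ring
    have c2 : ((j + q + 1).choose (j + 1) : S) = (j + q).choose j + (j + q).choose (j + 1) := by
      rw [Nat.choose_succ_succ]; push_cast; ring
    have c3 : ((j + q + 1 : ℕ) : S) * (j + q).choose j =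
        ((q + 1 : ℕ) : S) * (j + q + 1).choose j := by
      have e1 := Nat.add_one_mul_choose_eq (j + q) j
      have e2 := Nat.choose_succ_right_eq (j + q + 1) j
      rw [show j + q + 1 - j = q + 1 by omega] at e2
      rw [← Nat.cast_mul, ← Nat.cast_mul, e1, e2, mul_comm]
    have e1 : ∀ x : ℕ, j + q + 1 + x - (j + q + 1) = x := fun x => by omega
    have e2 : ∀ x : ℕ, j + q + 1 + x - (j + q + 1 - 1) = x + 1 := fun x => by omega
    have e3 : ∀ x : ℕ, j + q + 1 + (x + 1) - (j + q + 1 + 1) = x := fun x => by omega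
    have e4 : j + q + 1 + 1 - (j + 1) = q + 1 := by omega
    have e5 : j + q + 1 - (j + 1) = q := by omega
    have e6 : j + q + 1 - j = q + 1 := by omega
    have e7 : ∀ x : ℕ, j + (x + 1) + 1 - 1 - (j + 1) = x := fun x => by omega
    rcases d with _ | d <;> rcases q with _ | q <;> simp only [e1, e2, e3, e4, e5, e6, e7] <;>
      simp only [Nat.add_sub_cancel] at c1 c2 c3 ⊢
    · simp only [add_zero, Nat.choose_succ_self, Nat.cast_zero] at c1 c2 c3 ⊢
      push_cast at c3 ⊢
      linear_combination a * b * ((j + 1) * c2 + c3)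
    · push_cast at c3 ⊢
      linear_combination a * b ^ (q + 2) * ((j + q + 2) * c2 + c3)
    · simp only [add_zero, Nat.choose_succ_self, Nat.cast_zero] at c1 c2 c3 ⊢
      push_cast at c3 ⊢
      linear_combination a ^ (d + 2) * b * ((d + 1) * c1 + (j + 1) * c2 + c3)
    · push_cast at c3 ⊢
      linear_combination a ^ (d + 2) * b ^ (q + 2) * ((d + 1) * c1 + (j + q + 2) * c2 + c3)

/-- The combination of the frame vectors with coefficients `α`, in coordinates. -/
def frameSum (lam : ℕ) (a b : S) : (ℕ → S) →ₗ[S] (ℕ → S) where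
  toFun α m := ∑ j ∈ Finset.range (lam + 1), α j * frameCoeff lam a b j m
  map_add' α β := by ext m; simp [add_mul, Finset.sum_add_distrib]
  map_smul' r α := by ext m; simp [Finset.mul_sum, mul_assoc]

theorem frameSum_apply (lam : ℕ) (a b : S) (α : ℕ → S) (m : ℕ) :
    frameSum lam a b α m = ∑ j ∈ Finset.range (lam + 1), α j * frameCoeff lam a b j m := rfl

theorem frameSum_of_forall_eq_zero (lam : ℕ) (a b : S) {α : ℕ → S} (hα : ∀ j ≤ lam, α j = 0)
    (m : ℕ) : frameSum lam a b α m = 0 :=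
  (frameSum_apply ..).trans <| Finset.sum_eq_zero fun j hj => by
    rw [hα j (Nat.le_of_lt_succ (Finset.mem_range.1 hj)), zero_mul]

theorem rankOneOp_frameSum (lam : ℕ) (a b : S) (α : ℕ → S) {m : ℕ} (hm : m ≤ lam) :
    rankOneOp lam a b (frameSum lam a b α) m = frameSum lam a b (shift lam a α) m := by
  have e : rankOneOp lam a b (frameSum lam a b α) m =
      ∑ j ∈ Finset.range (lam + 1), α j * rankOneOp lam a b (frameCoeff lam a b j) m := by
    simp only [rankOneOp, frameSum_apply, Finset.mul_sum, ← Finset.sum_sub_distrib]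
    exact Finset.sum_congr rfl fun j _ => by ring
  rw [e, Finset.sum_range_succ', rankOneOp_frameCoeff_zero lam a b hm, mul_zero, add_zero,
    frameSum_apply, Finset.sum_range_succ, shift_apply, sub_self, mul_zero, zero_mul, zero_mul,
    add_zero]
  refine Finset.sum_congr rfl fun j _ => ?_
  rw [rankOneOp_frameCoeff_succ lam a b hm, shift_apply]
  ring

theorem frameSum_single (lam : ℕ) (a b : S) (m : ℕ) :
    frameSum lam a b (Pi.single 0 1) m = a ^ (lam - m) * b ^ m := by
  rw [frameSum_apply, Finset.sum_eq_single 0]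
  · simp [frameCoeff]
  · intro j _ hj
    simp [hj]
  · simp

/-- The matrix whose columns are the frame vectors; it is triangular with powers of `a` on the
diagonal. -/
def frameMatrix (lam : ℕ) (a b : S) : Matrix (Fin (lam + 1)) (Fin (lam + 1)) S :=
  .of fun m j => frameCoeff lam a b j m

theorem frameMatrix_mulVec (lam : ℕ) (a b : S) (α : ℕ → S) (m : Fin (lam + 1)) :
    (frameMatrix lam a b).mulVec (fun j => α j) m = frameSum lam a b α m := by
  rw [frameSum_apply, Finset.sum_range]
  simp only [Matrix.mulVec, dotProduct, frameMatrix, Matrix.of_apply, mul_comm]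

theorem det_frameMatrix (lam : ℕ) (a b : S) :
    ∃ n : ℕ, (frameMatrix lam a b).det = a ^ n := by
  refine ⟨∑ m : Fin (lam + 1), (lam - m.val), ?_⟩
  rw [Matrix.det_of_isLowerTriangular, ← Finset.prod_pow_eq_pow_sum]
  · exact Finset.prod_congr rfl fun m _ => by simp [frameMatrix, frameCoeff]
  · intro m j hmj
    simp [frameMatrix, frameCoeff, Nat.choose_eq_zero_of_lt (show m.val < j.val from hmj)]

theorem exists_pow_mul_eq_frameSum (lam : ℕ) (a b : S) :
    ∃ n : ℕ, ∀ g : ℕ → S, ∃ α, ∀ m ≤ lam, a ^ n * g m = frameSum lam a b α m := by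
  obtain ⟨n, hn⟩ := det_frameMatrix lam a b
  refine ⟨n, fun g => ?_⟩
  let β := (frameMatrix lam a b).adjugate.mulVec fun m => g m
  refine ⟨fun j => if hj : j < lam + 1 then β ⟨j, hj⟩ else 0, fun m hm => ?_⟩
  have := frameMatrix_mulVec lam a b (fun j => if hj : j < lam + 1 then β ⟨j, hj⟩ else 0)
    ⟨m, Nat.lt_succ_of_le hm⟩
  rw [← this]
  simp only [Fin.is_lt, dif_pos, Fin.eta]
  change _ = (frameMatrix lam a b).mulVec β _
  rw [Matrix.mulVec_mulVec, Matrix.mul_adjugate, hn, Matrix.smul_mulVec, Matrix.one_mulVec]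
  rfl

theorem frameSum_eq_zero [IsDomain S] (lam : ℕ) {a : S} (ha : a ≠ 0) (b : S) {α : ℕ → S}
    (hα : ∀ m ≤ lam, frameSum lam a b α m = 0) (j : ℕ) (hj : j ≤ lam) : α j = 0 := by
  obtain ⟨n, hn⟩ := det_frameMatrix lam a b
  have := Matrix.eq_zero_of_mulVec_eq_zero (M := frameMatrix lam a b) (v := fun j => α j)
    (by rw [hn]; exact pow_ne_zero n ha)
    (funext fun m => (frameMatrix_mulVec lam a b α m).trans (hα m (Nat.le_of_lt_succ m.2)))
  exact congrFun this ⟨j, Nat.lt_succ_of_le hj⟩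

end Frame

/-! ### Frames for the global operator on the Weyl module -/

section Coordinates
attribute [local instance] LieRing.ofAssociativeRing
variable (k : Type u) [Field k] (lam : ℕ)

/-- The coordinates on `k[s, t] ⊗ V(λ)` with respect to the basis `v_0, …, v_λ`. -/
def coords : coordRing k ⊗[k] (Fin (lam + 1) → k) ≃ₗ[coordRing k] (Fin (lam + 1) → coordRing k) :=
  TensorProduct.piScalarRight k (coordRing k) (coordRing k) (Fin (lam + 1))

variable {k lam}

theorem coords_baseChange (T : Matrix (Fin (lam + 1)) (Fin (lam + 1)) k)
    (v : coordRing k ⊗[k] (Fin (lam + 1) → k)) :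
    coords k lam ((Matrix.toLin' T).baseChange (coordRing k) v) =
      (T.map C).mulVec (coords k lam v) := by
  induction v with
  | zero => simp
  | add v v' h h' => rw [map_add, map_add, map_add, h, h', Matrix.mulVec_add]
  | tmul a m =>
    ext1 i
    simp [coords, Matrix.mulVec, dotProduct, smul_eq_C_mul, Finset.sum_mul, mul_assoc]

theorem weylE_mulVec (g : ℕ → coordRing k) (m : Fin (lam + 1)) :
    ((weylE k lam).map C).mulVec (fun j => g j) m = ((lam : coordRing k) - m.val) * g (m + 1) := by
  simp only [Matrix.mulVec, dotProduct, weylE, Matrix.map_apply, Matrix.of_apply]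
  by_cases hm : m.val < lam
  · rw [Finset.sum_eq_single (⟨m.val + 1, by omega⟩ : Fin (lam + 1))]
    · simp only [if_true, map_add, map_sub, map_natCast, map_one]
      push_cast
      ring
    · intro j _ hj
      have : m.val + 1 ≠ j.val := fun h => hj (Fin.ext h.symm)
      simp [this]
    · simp
  · rw [Finset.sum_eq_zero, show m.val = lam by omega, sub_self, zero_mul]
    intro j _
    have : m.val + 1 ≠ j.val := by omega
    simp [this]

theorem weylF_mulVec (g : ℕ → coordRing k) (m : Fin (lam + 1)) :
    ((weylF k lam).map C).mulVec (fun j => g j) m = (m.val : coordRing k) * g (m - 1) := by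
  simp only [Matrix.mulVec, dotProduct, weylF, Matrix.map_apply, Matrix.of_apply]
  by_cases hm : 0 < m.val
  · rw [Finset.sum_eq_single (⟨m.val - 1, by omega⟩ : Fin (lam + 1))]
    · have h1 : m.val - 1 + 1 = m.val := by omega
      simp [h1, Nat.cast_sub (show 1 ≤ m.val from hm)]
    · intro j _ hj
      have : m.val ≠ j.val + 1 := fun h => hj (Fin.ext (by simp [h]))
      simp [this]
    · simp
  · rw [Finset.sum_eq_zero, show m.val = 0 by omega, Nat.cast_zero, zero_mul]
    intro j _
    have : m.val ≠ j.val + 1 := by omega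
    simp [this]

theorem weylH_mulVec (g : ℕ → coordRing k) (m : Fin (lam + 1)) :
    ((weylH k lam).map C).mulVec (fun j => g j) m =
      ((lam : coordRing k) - 2 * m.val) * g m := by
  rw [weylH, Matrix.diagonal_map (map_zero C), Matrix.mulVec_diagonal]
  simp only [map_sub, map_mul, map_natCast, map_ofNat]

theorem coords_theta (g : ℕ → coordRing k) (m : Fin (lam + 1)) :
    coords k lam (theta (weylRep k lam) ((coords k lam).symm fun j => g j)) m =
      rankOneOp lam (X 0) (-X 1) g m := by
  simp only [theta, weylRep_e, weylRep_f, weylRep_h, iota_nx, iota_ny, iota_nz,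
    LinearMap.add_apply, LinearMap.smul_apply, map_add, map_smul, coords_baseChange,
    LinearEquiv.apply_symm_apply, Pi.add_apply, Pi.smul_apply, weylE_mulVec, weylF_mulVec,
    weylH_mulVec, smul_eq_mul, rankOneOp]
  ring

theorem rankOneOp_reverse {S : Type*} [CommRing S] (a b : S) (g : ℕ → S) {m : ℕ} (hm : m ≤ lam) :
    rankOneOp lam a b (fun j => g (lam - j)) m = - rankOneOp lam b a g (lam - m) := by
  simp only [rankOneOp]
  obtain ⟨d, rfl⟩ := Nat.exists_eq_add_of_le hm
  rcases m with _ | m <;> rcases d with _ | d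
  · simp
  · simp only [Nat.zero_add, Nat.sub_zero, Nat.add_sub_cancel]
    push_cast
    ring
  · simp only [Nat.add_zero, Nat.add_sub_cancel, Nat.sub_self, show m + 1 - m = 0 + 1 by omega]
    push_cast
    ring
  · simp only [show m + 1 + (d + 1) - (m + 1 + 1) = d by omega, show m + 1 - 1 = m by omega,
      show m + 1 + (d + 1) - m = d + 1 + 1 by omega,
      show m + 1 + (d + 1) - (m + 1) = d + 1 by omega, show d + 1 - 1 = d by omega]
    push_cast
    ring

variable (k lam)

/-- The element `w = ∑ s^(λ-m) (-t)^m v_m`, the divided power `(s x - t y)^(λ)`. -/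
def lineVec : coordRing k ⊗[k] (Fin (lam + 1) → k) :=
  (coords k lam).symm fun m => X 0 ^ (lam - m.val) * (-X 1) ^ m.val

theorem isShiftFrame_X_zero :
    IsShiftFrame (theta (weylRep k lam)) lam (X 0) (lineVec k lam)
      ((coords k lam).symm.toLinearMap ∘ₗ
        LinearMap.funLeft (coordRing k) (coordRing k) (Fin.val : Fin (lam + 1) → ℕ) ∘ₗ
          frameSum lam (X 0) (-X 1)) where
  map_shift α := by
    apply (coords k lam).injective
    ext1 m
    refine Eq.trans ?_ (coords_theta (frameSum lam (X 0) (-X 1) α) m).symm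
    rw [rankOneOp_frameSum lam _ _ _ (Nat.le_of_lt_succ m.2)]
    simp [LinearMap.funLeft]
  exists_eq := by
    obtain ⟨n, hn⟩ := exists_pow_mul_eq_frameSum lam (X 0 : coordRing k) (-X 1)
    refine ⟨n, fun v => ?_⟩
    obtain ⟨α, hα⟩ := hn fun m => if hm : m < lam + 1 then coords k lam v ⟨m, hm⟩ else 0
    refine ⟨α, (coords k lam).injective (funext fun m => ?_)⟩
    have := hα m (Nat.le_of_lt_succ m.2)
    rw [dif_pos m.2] at this
    simpa [LinearMap.funLeft] using this
  eq_zero_iff α := by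
    constructor
    · intro h
      refine frameSum_eq_zero lam (X_ne_zero 0) (-X 1) fun m hm => ?_
      have := congrFun ((coords k lam).symm.map_eq_zero_iff.1 h) ⟨m, Nat.lt_succ_of_le hm⟩
      exact this
    · intro h
      refine (coords k lam).symm.map_eq_zero_iff.2 (funext fun m => ?_)
      exact frameSum_of_forall_eq_zero lam _ _ h _
  map_single := by
    refine congrArg (coords k lam).symm (funext fun m => ?_)
    exact frameSum_single lam _ _ _

/-- The frame away from `t = 0` is the frame away from `s = 0` read backwards: reversing the
basis `v_0, …, v_λ` exchanges `s` and `-t` and changes the sign of the operator. -/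
theorem isShiftFrame_X_one :
    IsShiftFrame (theta (weylRep k lam)) lam (X 1) (lineVec k lam)
      ((coords k lam).symm.toLinearMap ∘ₗ
        LinearMap.funLeft (coordRing k) (coordRing k) (fun m : Fin (lam + 1) => lam - m.val) ∘ₗ
          frameSum lam (-X 1) (X 0)) where
  map_shift α := by
    apply (coords k lam).injective
    ext1 m
    refine Eq.trans ?_
      (coords_theta (fun j => frameSum lam (-X 1) (X 0) α (lam - j)) m).symm
    rw [rankOneOp_reverse _ _ _ (Nat.le_of_lt_succ m.2), rankOneOp_frameSum lam _ _ _ (by omega)]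
    have : shift lam (-X 1) α = - shift lam (X 1 : coordRing k) α := by
      ext1 j
      simp only [shift_apply, Pi.neg_apply]
      ring
    rw [this, map_neg]
    simp [LinearMap.funLeft]
  exists_eq := by
    obtain ⟨n, hn⟩ := exists_pow_mul_eq_frameSum lam (-X 1 : coordRing k) (X 0)
    refine ⟨n, fun v => ?_⟩
    obtain ⟨α, hα⟩ := hn fun m =>
      if hm : lam - m < lam + 1 then coords k lam v ⟨lam - m, hm⟩ else 0
    refine ⟨((-1) ^ n : coordRing k) • α, (coords k lam).injective (funext fun m => ?_)⟩
    have := hα (lam - m) (Nat.sub_le _ _)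
    rw [dif_pos (by omega)] at this
    have hm : (⟨lam - (lam - m.val), by omega⟩ : Fin (lam + 1)) = m := Fin.ext (by simp; omega)
    rw [hm] at this
    rw [map_smul, map_smul, LinearMap.comp_apply, LinearEquiv.coe_coe, map_smul,
      LinearEquiv.apply_symm_apply]
    simp only [LinearMap.comp_apply, Pi.smul_apply, LinearMap.funLeft_apply, smul_eq_mul]
    rw [← this, neg_pow (X 1 : coordRing k) n, ← mul_assoc, ← mul_assoc, ← mul_pow]
    simp
  eq_zero_iff α := by
    constructor
    · intro h
      refine frameSum_eq_zero lam (neg_ne_zero.2 (X_ne_zero 1)) (X 0) fun m hm => ?_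
      have := congrFun ((coords k lam).symm.map_eq_zero_iff.1 h)
        ⟨lam - m, Nat.lt_succ_of_le (Nat.sub_le _ _)⟩
      change frameSum lam _ _ α (lam - (lam - m)) = 0 at this
      rwa [Nat.sub_sub_self hm] at this
    · intro h
      refine (coords k lam).symm.map_eq_zero_iff.2 (funext fun m => ?_)
      exact frameSum_of_forall_eq_zero lam _ _ h _
  map_single := by
    refine congrArg (coords k lam).symm (funext fun m => ?_)
    refine (frameSum_single lam _ _ _).trans ?_
    rw [Nat.sub_sub_self (Nat.le_of_lt_succ m.2), mul_comm]

theorem exists_isShiftFrame (c : Fin 2) :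
    ∃ F, IsShiftFrame (theta (weylRep k lam)) lam (X c) (lineVec k lam) F := by
  fin_cases c
  · exact ⟨_, isShiftFrame_X_zero k lam⟩
  · exact ⟨_, isShiftFrame_X_one k lam⟩

theorem theta_lineVec : theta (weylRep k lam) (lineVec k lam) = 0 :=
  (isShiftFrame_X_zero k lam).apply_eq_zero

end Coordinates

/-! ### Homogeneous parts, kernels and images of the global operator -/

section Homogeneous
attribute [local instance] LieRing.ofAssociativeRing MvPolynomial.gradedAlgebra
variable {k : Type u} [Field k] {M : Type u} [AddCommGroup M] [Module k M]

theorem homogeneousComponent_mul_of_mem {c : coordRing k} {e : ℕ} (hc : c ∈ grading k e) (d : ℕ)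
    (a : coordRing k) :
    homogeneousComponent (e + d) (c * a) = c * homogeneousComponent d a := by
  rw [← decomposition.decompose'_apply, ← decomposition.decompose'_apply]
  exact DirectSum.coe_decompose_mul_add_of_left_mem (grading k) hc

theorem homogeneousComponent_mul_of_lt {c : coordRing k} {e : ℕ} (hc : c ∈ grading k e) {d : ℕ}
    (hd : d < e) (a : coordRing k) : homogeneousComponent d (c * a) = 0 := by
  rw [← decomposition.decompose'_apply]
  exact DirectSum.coe_decompose_mul_of_left_mem_of_not_le (grading k) hc (not_le.2 hd)

variable (M) in
/-- The projection of `k[s, t] ⊗ M` to its part of degree `d`. -/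
def homProj (d : ℕ) : coordRing k ⊗[k] M →ₗ[k] coordRing k ⊗[k] M :=
  (homogeneousComponent d).rTensor M

theorem homProj_mem {n i : ℤ} {d : ℕ} (h : i + n = d) (v : coordRing k ⊗[k] M) :
    homProj M d v ∈ (tensorMod k M n).deg i := by
  induction v with
  | zero => rw [map_zero]; exact zero_mem _
  | add v v' hv hv' => rw [map_add]; exact add_mem hv hv'
  | tmul a m =>
    refine ⟨⟨homogeneousComponent d a, ?_⟩ ⊗ₜ m, rfl⟩
    rw [h]
    exact homogeneousComponent_mem d a

theorem homProj_of_mem {n i : ℤ} {d : ℕ} (h : i + n = d) {v : coordRing k ⊗[k] M}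
    (hv : v ∈ (tensorMod k M n).deg i) : homProj M d v = v := by
  obtain ⟨t, rfl⟩ := hv
  induction t with
  | zero => simp
  | add t t' ht ht' => rw [map_add, map_add, ht, ht']
  | tmul b m =>
    have hb : b.1 ∈ intGrading k d := h ▸ b.2
    exact congrArg (· ⊗ₜ m) (homogeneousComponent_eq_self hb)

theorem homProj_smul {c : coordRing k} {e : ℕ} (hc : c ∈ grading k e) (d : ℕ)
    (v : coordRing k ⊗[k] M) : homProj M (e + d) (c • v) = c • homProj M d v := by
  induction v with
  | zero => simp
  | add v v' hv hv' => rw [smul_add, map_add, map_add, smul_add, hv, hv']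
  | tmul a m => exact congrArg (· ⊗ₜ m) (homogeneousComponent_mul_of_mem hc d a)

theorem homProj_smul_right {e : ℕ} {w : coordRing k ⊗[k] M} (hw : w ∈ (tensorMod k M 0).deg e)
    (d : ℕ) (y : coordRing k) :
    homProj M (e + d) (y • w) = homogeneousComponent d y • w := by
  obtain ⟨t, rfl⟩ := hw
  induction t with
  | zero => simp
  | add t t' ht ht' => rw [map_add, smul_add, smul_add, map_add, ht, ht']
  | tmul b m =>
    have hb : ∀ j : ℤ, j = e → ∀ a ∈ intGrading k j, a ∈ grading k e := by
      rintro _ rfl a ha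
      exact ha
    replace hb := hb _ (add_zero _) _ b.2
    refine congrArg (· ⊗ₜ m) ?_
    change homogeneousComponent (e + d) (y * b.1) = homogeneousComponent d y * b.1
    rw [mul_comm, homogeneousComponent_mul_of_mem hb, mul_comm]

theorem homProj_smul_right_of_lt {e : ℕ} {w : coordRing k ⊗[k] M}
    (hw : w ∈ (tensorMod k M 0).deg e) {d : ℕ} (hd : d < e) (y : coordRing k) :
    homProj M d (y • w) = 0 := by
  obtain ⟨t, rfl⟩ := hw
  induction t with
  | zero => simp
  | add t t' ht ht' => rw [map_add, smul_add, map_add, ht, ht', add_zero]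
  | tmul b m =>
    have hb : ∀ j : ℤ, j = e → ∀ a ∈ intGrading k j, a ∈ grading k e := by
      rintro _ rfl a ha
      exact ha
    replace hb := hb _ (add_zero _) _ b.2
    have : homogeneousComponent d (y * b.1) = 0 := by
      rw [mul_comm, homogeneousComponent_mul_of_lt hb hd]
    exact (congrArg (· ⊗ₜ m) this).trans (zero_tmul _ _)

theorem exists_homProj_smul_eq {e : ℕ} {w : coordRing k ⊗[k] M}
    (hw : w ∈ (tensorMod k M 0).deg e) (d : ℕ) (y : coordRing k) :
    ∃ y' ∈ intGrading k (d + -(e : ℤ)), homProj M d (y • w) = y' • w := by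
  rcases lt_or_ge d e with hd | hd
  · exact ⟨0, zero_mem _, by rw [homProj_smul_right_of_lt hw hd, zero_smul]⟩
  · obtain ⟨f, rfl⟩ := Nat.exists_eq_add_of_le hd
    refine ⟨homogeneousComponent f y, ?_, homProj_smul_right hw f y⟩
    rw [show ((e + f : ℕ) : ℤ) + -(e : ℤ) = (f : ℕ) by push_cast; ring]
    exact homogeneousComponent_mem f y

variable (ρ : sl2 k →ₗ⁅k⁆ Module.End k M)

theorem X_mem_grading (c : Fin 2) : (X c : coordRing k) ∈ grading k 1 := isHomogeneous_X k c

theorem X_pow_mem_grading (c : Fin 2) (n : ℕ) : (X c ^ n : coordRing k) ∈ grading k n :=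
  isHomogeneous_X_pow c n

theorem homProj_theta (d : ℕ) (v : coordRing k ⊗[k] M) :
    homProj M (2 + d) (theta ρ v) = theta ρ (homProj M d v) := by
  have hx : iota k (nx k) ∈ grading k 2 := by
    rw [iota_nx]; exact X_pow_mem_grading 0 2
  have hy : iota k (ny k) ∈ grading k 2 := by
    rw [iota_ny]; exact neg_mem (X_pow_mem_grading 1 2)
  have hz : iota k (nz k) ∈ grading k 2 := by
    rw [iota_nz]; exact SetLike.GradedMul.mul_mem (X_mem_grading 0) (X_mem_grading 1)
  have hT : ∀ T : Module.End k M,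
      homProj M d (T.baseChange (coordRing k) v) = T.baseChange (coordRing k) (homProj M d v) := by
    intro T
    induction v with
    | zero => simp
    | add v v' h h' => simp only [map_add, h, h']
    | tmul a m => rfl
  simp only [theta, LinearMap.add_apply, LinearMap.smul_apply, map_add, homProj_smul hx,
    homProj_smul hy, homProj_smul hz, hT]

theorem homProj_theta_pow (i d : ℕ) (v : coordRing k ⊗[k] M) :
    homProj M (2 * i + d) ((theta ρ ^ i) v) = (theta ρ ^ i) (homProj M d v) := by
  induction i generalizing d v with
  | zero => simp
  | succ i ih =>
    rw [pow_succ', Module.End.mul_apply, Module.End.mul_apply, ← ih, ← homProj_theta,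
      show 2 * (i + 1) + d = 2 + (2 * i + d) by ring]

theorem theta_pow_mem (j : ℕ) {n m : ℤ} (hm : m = n + 2 * j) (i : ℤ) (v : coordRing k ⊗[k] M)
    (hv : v ∈ (tensorMod k M n).deg i) : (theta ρ ^ j) v ∈ (tensorMod k M m).deg i := by
  induction j generalizing n v with
  | zero =>
    obtain rfl : m = n := by simpa using hm
    exact hv
  | succ j ih =>
    rw [pow_succ, Module.End.mul_apply]
    exact ih (n := n + 2) (by rw [hm]; push_cast; ring) _ (theta_mem ρ rfl i v hv)

theorem globalOpPow_eq (j : ℕ) (n m : ℤ) (hm : m = n + 2 * j) :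
    globalOpPow ρ j n m hm =
      tildeMap (N := tensorMod k M n) (N' := tensorMod k M m) (theta ρ ^ j)
        (theta_pow_mem ρ j hm) := by
  induction j generalizing n with
  | zero =>
    obtain rfl : m = n := by simpa using hm
    exact (tildeMap_id _).symm
  | succ j ih =>
    rw [globalOpPow, ih]
    exact tildeMap_comp _ _ _ _ _ _ fun i v _ =>
      (LinearMap.congr_fun (pow_succ (theta ρ) j) v).symm

/-- The saturation of the range of `Θ^i`: the elements of `k[s, t] ⊗ M` that some power of `s` and
some power of `t` multiply into the range. -/
def satRange (i : ℕ) : Submodule (coordRing k) (coordRing k ⊗[k] M) where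
  carrier := {v | ∀ c : Fin 2, ∃ (n : ℕ) (v' : coordRing k ⊗[k] M),
    (X c : coordRing k) ^ n • v = (theta ρ ^ i) v'}
  zero_mem' c := ⟨0, 0, by simp⟩
  add_mem' {v₁ v₂} h₁ h₂ c := by
    obtain ⟨n₁, v₁', e₁⟩ := h₁ c
    obtain ⟨n₂, v₂', e₂⟩ := h₂ c
    refine ⟨n₁ + n₂, (X c : coordRing k) ^ n₂ • v₁' + (X c : coordRing k) ^ n₁ • v₂', ?_⟩
    rw [map_add, map_smul, map_smul, ← e₁, ← e₂, smul_smul, smul_smul, ← pow_add, ← pow_add,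
      add_comm n₂, smul_add]
  smul_mem' a v h c := by
    obtain ⟨n, v', e⟩ := h c
    exact ⟨n, a • v', by rw [map_smul, ← e, smul_comm]⟩

theorem theta_pow_mem_satRange (i : ℕ) (v : coordRing k ⊗[k] M) :
    (theta ρ ^ i) v ∈ satRange ρ i :=
  fun _ => ⟨0, v, by rw [pow_zero, one_smul]⟩

/-- Taking homogeneous parts in an equation `c^n v = Θ^i v'`. The extra factor `c^(2i)` makes up for
`Θ^i` raising degrees by `2i`. -/
theorem theta_pow_homProj {i n : ℕ} {c : Fin 2} {v v' : coordRing k ⊗[k] M}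
    (e : (X c : coordRing k) ^ n • v = (theta ρ ^ i) v') (d : ℕ) :
    (theta ρ ^ i) (homProj M (n + d) ((X c : coordRing k) ^ (2 * i) • v')) =
      (X c : coordRing k) ^ (2 * i + n) • homProj M d v := by
  rw [← homProj_theta_pow, map_smul, ← e, smul_smul, ← pow_add, ← add_assoc,
    homProj_smul (X_pow_mem_grading c _)]

theorem homProj_mem_satRange {i : ℕ} {v : coordRing k ⊗[k] M} (hv : v ∈ satRange ρ i) (d : ℕ) :
    homProj M d v ∈ satRange ρ i := fun c => by
  obtain ⟨n, v', e⟩ := hv c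
  exact ⟨2 * i + n, _, (theta_pow_homProj ρ e d).symm⟩

/-- A point of the projective line is not a zero of both `s` and `t`. -/
theorem exists_X_notMem (x : Proj (grading k)) :
    ∃ c : Fin 2, (X c : coordRing k) ∉ (ProjectiveSpectrum.asHomogeneousIdeal x).toIdeal := by
  by_contra! h
  refine x.not_irrelevant_le fun a ha => ?_
  have ha0 : coeff 0 a = 0 := by
    have h0 := (HomogeneousIdeal.mem_irrelevant_iff (grading k) a).1 ha
    rw [GradedRing.proj_apply] at h0
    have : homogeneousComponent 0 a = 0 := (decomposition.decompose'_apply a 0).symm.trans h0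
    rw [homogeneousComponent_zero] at this
    simpa using this
  have hmem : a ∈ Ideal.span ((X : Fin 2 → coordRing k) '' Set.univ) := by
    rw [mem_ideal_span_X_image]
    intro m hm
    by_contra! h'
    have : m = 0 := Finsupp.ext fun i => h' i trivial
    rw [this, mem_support_iff] at hm
    exact hm ha0
  refine Ideal.span_le.2 ?_ hmem
  rintro _ ⟨c, -, rfl⟩
  exact h c

/-- The subsheaf of `𝒪 ⊗ M` whose sections are locally fractions with numerator in `P`. -/
def subsheaf (P : Submodule (coordRing k) (coordRing k ⊗[k] M)) : (P1 k).Modules :=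
  tilde ((tensorMod k M 0).restrict P)

/-- The inclusion of `subsheaf P` into `𝒪 ⊗ M`. -/
def subsheafIncl (P : Submodule (coordRing k) (coordRing k ⊗[k] M)) :
    subsheaf P ⟶ tensorSheaf k M 0 :=
  incl (tensorMod k M 0) P

instance (P : Submodule (coordRing k) (coordRing k ⊗[k] M)) : Mono (subsheafIncl P) :=
  mono_incl (tensorMod k M 0) P

theorem gim_eq (i : ℕ) :
    gim ρ i = Subobject.mk (subsheafIncl (satRange ρ i)) := by
  refine (congrArg (fun f => imageSubobject f) (globalOpPow_eq ρ i _ _ _)).trans ?_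
  refine imageSubobject_tildeMap (tensorMod k M (-(2 * i))) (tensorMod k M 0) (satRange ρ i) _ _
    (theta_pow_mem_satRange ρ i) fun x d v hv hvi => ?_
  obtain ⟨c, hc⟩ := exists_X_notMem x
  obtain ⟨n, v', e⟩ := hvi c
  refine ⟨2 * i + n, X c ^ (2 * i + n), fun h => hc ((isPrime_top x).mem_of_pow_mem _ h),
    X_pow_mem_grading c _, homProj M (n + d) ((X c : coordRing k) ^ (2 * i) • v'),
    homProj_mem (by push_cast; ring) _, ?_⟩
  exact (theta_pow_homProj ρ e d).trans
    (congrArg (fun u => (X c : coordRing k) ^ (2 * i + n) • u) (homProj_of_mem (add_zero _) hv))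

theorem gker_inf_gim_eq [Module.IsTorsionFree (coordRing k) (coordRing k ⊗[k] M)] (i : ℕ) :
    gker ρ 1 ⊓ gim ρ i =
      Subobject.mk (subsheafIncl (LinearMap.ker (theta ρ) ⊓ satRange ρ i)) := by
  have (n : ℤ) : Module.IsTorsionFree (coordRing k) (tensorMod k M n).carrier :=
    inferInstanceAs (Module.IsTorsionFree (coordRing k) (coordRing k ⊗[k] M))
  have hker : gker ρ 1 = Subobject.mk (subsheafIncl (LinearMap.ker (theta ρ))) := by
    refine (congrArg (fun f => kernelSubobject f) (globalOpPow_eq ρ 1 _ _ _)).trans ?_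
    exact (kernelSubobject_tildeMap (tensorMod k M 0) (tensorMod k M (2 * (1 : ℕ))) _ _).trans
      (by rw [pow_one]; rfl)
  rw [gim_eq, hker]
  exact mk_incl_inf (tensorMod k M 0) _ _

end Homogeneous

/-! ### Quotients of subobjects in an abelian category -/

/-- The quotient `B / A` is isomorphic to `L` via `w : L ⟶ B` if `L` meets `A` in zero and, together
with `A`, generates `B`. -/
theorem nonempty_cokernel_ofLE_iso {𝒞 : Type*} [Category 𝒞] [Abelian 𝒞] {X A B L : 𝒞}
    (a : A ⟶ X) (b : B ⟶ X) [Mono a] [Mono b] {SA SB : Subobject X} (hA : SA = Subobject.mk a)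
    (hB : SB = Subobject.mk b) (h : SA ≤ SB) (i : A ⟶ B) (hi : i ≫ b = a) (w : L ⟶ B)
    (hmono : ∀ (Z : 𝒞) (g : Z ⟶ L) (g' : Z ⟶ A), g ≫ w = g' ≫ i → g = 0)
    (hepi : ∀ (Z : 𝒞) (g : B ⟶ Z), w ≫ g = 0 → i ≫ g = 0 → g = 0) :
    Nonempty (cokernel (Subobject.ofLE SA SB h) ≅ L) := by
  subst hA hB
  have : Mono i := mono_of_mono_fac hi
  let e : cokernel (Subobject.ofLE (Subobject.mk a) (Subobject.mk b) h) ≅ cokernel i :=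
    cokernel.mapIso _ _ (Subobject.underlyingIso a) (Subobject.underlyingIso b) (by
      rw [← cancel_mono b]
      simp [hi])
  have : Mono (w ≫ cokernel.π i) := Preadditive.mono_of_cancel_zero _ fun {Z} g hg =>
    hmono Z g (Abelian.monoLift i (g ≫ w) (by rw [Category.assoc, hg]))
      (Abelian.monoLift_comp ..).symm
  have : Epi (w ≫ cokernel.π i) := Preadditive.epi_of_cancel_zero _ fun {Z} g hg => by
    rw [← cancel_epi (cokernel.π i), comp_zero]
    exact hepi Z _ (by rw [← Category.assoc, hg]) (by rw [cokernel.condition_assoc, zero_comp])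
  have := isIso_of_mono_of_epi (w ≫ cokernel.π i)
  exact ⟨e ≪≫ (asIso (w ≫ cokernel.π i)).symm⟩

theorem isZero_cokernel_ofLE {𝒞 : Type*} [Category 𝒞] [Abelian 𝒞] {X : 𝒞} {A B : Subobject X}
    (h : A ≤ B) (h' : B ≤ A) : IsZero (cokernel (A.ofLE B h)) := by
  obtain rfl := le_antisymm h h'
  rw [Subobject.ofLE_refl]
  exact isZero_cokernel_of_epi _

/-! ### The kernel of the global operator on the Weyl module -/

section Weyl
attribute [local instance] LieRing.ofAssociativeRing MvPolynomial.gradedAlgebra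
variable (k : Type u) [Field k] (lam : ℕ)

variable {k lam} in
theorem coords_homProj (d : ℕ) (v : coordRing k ⊗[k] (Fin (lam + 1) → k)) (m : Fin (lam + 1)) :
    coords k lam (homProj _ d v) m = homogeneousComponent d (coords k lam v m) := by
  induction v with
  | zero => simp
  | add v v' hv hv' => simp only [map_add, Pi.add_apply, hv, hv']
  | tmul a x =>
    change x m • homogeneousComponent d a = homogeneousComponent d (x m • a)
    rw [map_smul]

theorem lineVec_mem : lineVec k lam ∈ (tensorMod k (Fin (lam + 1) → k) 0).deg lam := by
  have : homProj _ lam (lineVec k lam) = lineVec k lam := by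
    apply (coords k lam).injective
    ext1 m
    rw [coords_homProj, lineVec, LinearEquiv.apply_symm_apply]
    refine homogeneousComponent_eq_self ?_
    have h := SetLike.GradedMul.mul_mem (A := grading k) (X_pow_mem_grading 0 (lam - m.val))
      (SetLike.pow_mem_graded m.val (neg_mem (X_mem_grading 1)))
    rwa [smul_eq_mul, mul_one, Nat.sub_add_cancel (Nat.le_of_lt_succ m.2)] at h
  rw [← this]
  exact homProj_mem (by simp) _

theorem smul_lineVec_mem {j : ℤ} {y : coordRing k} (hy : y ∈ intGrading k (j + -(lam : ℤ))) :
    y • lineVec k lam ∈ (tensorMod k (Fin (lam + 1) → k) 0).deg j := by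
  obtain ⟨n, hn⟩ | hneg : (∃ n : ℕ, j + -(lam : ℤ) = n) ∨ j + -(lam : ℤ) < 0 := by
    rcases lt_or_ge (j + -(lam : ℤ)) 0 with h | h
    · exact Or.inr h
    · exact Or.inl ⟨_, (Int.toNat_of_nonneg h).symm⟩
  · rw [hn] at hy
    obtain rfl : j = n + lam := by omega
    exact (tensorMod k (Fin (lam + 1) → k) 0).smul_mem hy (lineVec_mem k lam)
  · obtain ⟨n, hn⟩ := Int.eq_negSucc_of_lt_zero hneg
    rw [hn] at hy
    rw [show y = 0 from hy, zero_smul]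
    exact zero_mem _

variable {k lam} in
/-- The morphism `𝒪(-λ) ⟶ subsheaf P`, `1 ↦ w`, if `w ∈ P`. -/
def lineMap {P : Submodule (coordRing k) (coordRing k ⊗[k] (Fin (lam + 1) → k))}
    (hP : lineVec k lam ∈ P) : O k (-(lam : ℤ)) ⟶ subsheaf P :=
  tildeMap (N := twistMod k (-(lam : ℤ))) (N' := (tensorMod k (Fin (lam + 1) → k) 0).restrict P)
    (LinearMap.toSpanSingleton (coordRing k) _ (lineVec k lam))
    fun _ y hy => ⟨smul_lineVec_mem k lam hy, P.smul_mem y hP⟩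

variable {p : ℕ} [Fact p.Prime] [CharP k p] {i : ℕ}

theorem lineVec_mem_satRange (hi : ¬ p ∣ lam.descFactorial i) :
    lineVec k lam ∈ satRange (weylRep k lam) i := fun c => by
  obtain ⟨F, hF⟩ := exists_isShiftFrame k lam c
  exact hF.exists_pow_smul_eq (p := p) hi

/-- If `e_0` is not in the saturated range of `Θ^i`, then an element of the kernel differs from an
element of that range by a multiple of `e_0 = w`. Away from `s = 0` and away from `t = 0` the
multiple is `x_s / s^n` and `x_t / t^m`; these agree, hence are a polynomial. -/
theorem exists_sub_smul_mem_satRange (hip : i < p) (hi : p ∣ lam.descFactorial i)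
    {v : coordRing k ⊗[k] (Fin (lam + 1) → k)} (hv : theta (weylRep k lam) v = 0) :
    ∃ y : coordRing k, v - y • lineVec k lam ∈ satRange (weylRep k lam) i := by
  have key : ∀ c : Fin 2, ∃ (n : ℕ) (x : coordRing k) (v' : coordRing k ⊗[k] (Fin (lam + 1) → k)),
      (X c : coordRing k) ^ n • v = x • lineVec k lam + (theta (weylRep k lam) ^ i) v' := by
    intro c
    obtain ⟨F, hF⟩ := exists_isShiftFrame k lam c
    exact hF.exists_pow_smul_eq_add (p := p) (X_ne_zero c) hip hv
  choose n x v' e using key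
  have hx : (X 1 : coordRing k) ^ n 1 * x 0 = X 0 ^ n 0 * x 1 := by
    rw [← sub_eq_zero]
    refine (isShiftFrame_X_zero k lam).eq_zero_of_smul_eq (p := p) (X_ne_zero 0) hi
      (v := (X 0 : coordRing k) ^ n 0 • v' 1 - (X 1 : coordRing k) ^ n 1 • v' 0) ?_
    rw [map_sub, map_smul, map_smul, ← sub_eq_of_eq_add' (e 0), ← sub_eq_of_eq_add' (e 1), sub_smul,
      mul_smul, mul_smul, smul_sub, smul_sub, 
      smul_comm ((X 1 : coordRing k) ^ n 1) ((X 0 : coordRing k) ^ n 0) v]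
    abel
  have hdvd : (X 0 : coordRing k) ^ n 0 ∣ x 0 := by
    refine (X_prime (i := (0 : Fin 2))).pow_dvd_of_dvd_mul_left _ (fun h => ?_) ⟨_, hx⟩
    have := X_dvd_X.1 ((X_prime (R := k) (i := (0 : Fin 2))).dvd_of_dvd_pow h)
    simp at this
  obtain ⟨y, hy⟩ := hdvd
  have hy1 : x 1 = X 1 ^ n 1 * y := by
    refine mul_left_cancel₀ (pow_ne_zero (n 0) (X_ne_zero 0)) ?_
    rw [← hx, hy]
    ring
  refine ⟨y, fun c => ⟨n c, v' c, ?_⟩⟩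
  have hyc : x c = X c ^ n c * y := by
    fin_cases c
    · exact hy
    · exact hy1
  rw [smul_sub, e c, hyc, mul_smul, add_sub_cancel_left]

/-- Homogeneous form of `exists_sub_smul_mem_satRange`. -/
theorem exists_homogeneous_sub_smul_mem_satRange (hip : i < p) (hi : p ∣ lam.descFactorial i)
    {v : coordRing k ⊗[k] (Fin (lam + 1) → k)} (hv : theta (weylRep k lam) v = 0) {d : ℕ}
    (hvd : v ∈ (tensorMod k (Fin (lam + 1) → k) 0).deg d) :
    ∃ y ∈ intGrading k (d + -(lam : ℤ)),
      v - y • lineVec k lam ∈ satRange (weylRep k lam) i := by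
  obtain ⟨y, hy⟩ := exists_sub_smul_mem_satRange k lam hip hi hv
  obtain ⟨y', hy', e⟩ := exists_homProj_smul_eq (lineVec_mem k lam) d y
  refine ⟨y', hy', ?_⟩
  have := homProj_mem_satRange _ hy d
  rwa [map_sub, e, homProj_of_mem (add_zero _) hvd] at this

theorem ker_inf_satRange_le {q : ℕ} (hq : q + 1 < p)
    (h : ¬ p ∣ lam.descFactorial (q + 1) ∨ p ∣ lam.descFactorial q) :
    LinearMap.ker (theta (weylRep k lam)) ⊓ satRange (weylRep k lam) q ≤
      LinearMap.ker (theta (weylRep k lam)) ⊓ satRange (weylRep k lam) (q + 1) := by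
  rintro v ⟨hv, hvq⟩
  refine ⟨hv, fun c => ?_⟩
  obtain ⟨F, hF⟩ := exists_isShiftFrame k lam c
  obtain ⟨n, x, v', e⟩ := hF.exists_pow_smul_eq_add (p := p) (X_ne_zero c) hq hv
  rcases h with h | h
  · obtain ⟨m, u, hu⟩ := hF.exists_pow_smul_eq (p := p) h
    refine ⟨m + n, x • u + (X c : coordRing k) ^ m • v', ?_⟩
    rw [pow_add, mul_smul, e, smul_add, smul_comm, hu, map_add, map_smul, map_smul]
  · obtain ⟨m, u, hu⟩ := hvq c
    have hx := hF.eq_zero_of_dvd (p := p) (X_ne_zero c) h (Nat.le_succ q) hu e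
    exact ⟨n, v', by rw [e, hx, zero_smul, zero_add]⟩

end Weyl

/-! ### The subquotients of the kernel filtration -/

section Sheaf
attribute [local instance] LieRing.ofAssociativeRing MvPolynomial.gradedAlgebra
variable {k : Type u} [Field k] {M : Type u} [AddCommGroup M] [Module k M]

theorem satRange_succ_le (ρ : sl2 k →ₗ⁅k⁆ Module.End k M) (i : ℕ) :
    satRange ρ (i + 1) ≤ satRange ρ i := fun v hv c => by
  obtain ⟨n, v', e⟩ := hv c
  exact ⟨n, theta ρ v', by rw [e, pow_succ, Module.End.mul_apply]⟩

/-- The inclusion between two subsheaves of `𝒪 ⊗ M`. -/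
def subsheafInclOfLE {P Q : Submodule (coordRing k) (coordRing k ⊗[k] M)} (h : P ≤ Q) :
    subsheaf P ⟶ subsheaf Q :=
  inclOfLE (tensorMod k M 0) h

theorem subsheafInclOfLE_comp {P Q : Submodule (coordRing k) (coordRing k ⊗[k] M)} (h : P ≤ Q) :
    subsheafInclOfLE h ≫ subsheafIncl Q = subsheafIncl P :=
  inclOfLE_comp_incl (tensorMod k M 0) h

variable {p : ℕ} [CharP k p] {q lam : ℕ}

/-- A section of `𝒪(-λ)` whose product with `w` lies in the subsheaf of fractions with numerator in
the saturated range of `Θ^i` vanishes. -/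
theorem eq_zero_of_comp_lineMap {i : ℕ} (hi : p ∣ lam.descFactorial i)
    {P Q : Submodule (coordRing k) (coordRing k ⊗[k] (Fin (lam + 1) → k))} (hPQ : P ≤ Q)
    (hP : P ≤ satRange (weylRep k lam) i) (hw : lineVec k lam ∈ Q) {Z : (P1 k).Modules}
    {g : Z ⟶ O k (-(lam : ℤ))} {g' : Z ⟶ subsheaf P}
    (hg : g ≫ lineMap hw = g' ≫ subsheafInclOfLE hPQ) : g = 0 := by
  have : Module.IsTorsionFree (coordRing k)
      ((tensorMod k (Fin (lam + 1) → k) 0).restrict Q).carrier :=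
    inferInstanceAs (Module.IsTorsionFree (coordRing k) (coordRing k ⊗[k] (Fin (lam + 1) → k)))
  have H : ∀ (m₁ b₁ b₂ : coordRing k), ∀ m₂ ∈ P, b₂ ≠ 0 →
      b₂ • m₁ • lineVec k lam = b₁ • m₂ → m₁ = 0 := by
    intro m₁ b₁ b₂ m₂ hm₂ hb₂ e
    obtain ⟨n, v', e'⟩ := (satRange (weylRep k lam) i).smul_mem b₁ (hP hm₂) 0
    rw [← e, smul_smul, smul_smul] at e'
    have h0 := (isShiftFrame_X_zero k lam).eq_zero_of_smul_eq (p := p) (X_ne_zero 0) hi e'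
    exact (mul_eq_zero.1 h0).resolve_left (mul_ne_zero (pow_ne_zero n (X_ne_zero 0)) hb₂)
  exact eq_zero_of_comp_tildeMap_eq ((tensorMod k (Fin (lam + 1) → k) 0).restrict Q)
    (N₂ := (tensorMod k (Fin (lam + 1) → k) 0).restrict P) (hψ := fun _ _ hm => ⟨hm.1, hPQ hm.2⟩)
    (fun j m₁ m₂ hm₂ b₁ b₂ hb₂ e => H m₁ b₁ b₂ m₂ hm₂.2 hb₂ e) hg

/-- The subsheaf cut out by the kernel of `Θ` and the saturated range of `Θ^q` is generated by `w`
and the subsheaf cut out by the kernel of `Θ` and the saturated range of `Θ^i`, for `i > q`. -/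
theorem eq_zero_of_lineMap_comp [Fact p.Prime] {i : ℕ} (hip : i < p) (hi : p ∣ lam.descFactorial i)
    {P Q : Submodule (coordRing k) (coordRing k ⊗[k] (Fin (lam + 1) → k))} (hPQ : P ≤ Q)
    (hP : LinearMap.ker (theta (weylRep k lam)) ⊓ satRange (weylRep k lam) i ≤ P)
    (hQ : Q ≤ LinearMap.ker (theta (weylRep k lam)))
    (hw : lineVec k lam ∈ Q) {Z : (P1 k).Modules} {g : subsheaf Q ⟶ Z}
    (hg : lineMap hw ≫ g = 0) (hg' : subsheafInclOfLE hPQ ≫ g = 0) : g = 0 := by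
  refine eq_zero_of_tildeMap_comp_eq_zero (N := (tensorMod k (Fin (lam + 1) → k) 0).restrict Q)
    (N'' := (tensorMod k (Fin (lam + 1) → k) 0).restrict P) (hψ := fun _ _ hm => ⟨hm.1, hPQ hm.2⟩)
    (fun d m hm => ?_) hg hg'
  obtain ⟨y, hy, hyP⟩ := exists_homogeneous_sub_smul_mem_satRange k lam hip hi (hQ hm.2) hm.1
  have hyw := smul_lineVec_mem k lam hy
  exact ⟨y, hy, _, ⟨AddSubgroup.sub_mem _ hm.1 hyw,
    hP ⟨Submodule.sub_mem _ (hQ hm.2) (Submodule.smul_mem _ y (hQ hw)), hyP⟩⟩,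
    add_sub_cancel _ _⟩

variable (k lam)

/-- The filtration step at which the quotient is the line bundle generated by `w`. -/
theorem nonempty_sheafF_iso [Fact p.Prime] (hip : q + 1 < p) (hq : ¬ p ∣ lam.descFactorial q)
    (hi : p ∣ lam.descFactorial (q + 1)) :
    Nonempty (sheafF (weylRep k lam) (q + 1) ≅ O k (-(lam : ℤ))) := by
  have hw : lineVec k lam ∈
      LinearMap.ker (theta (weylRep k lam)) ⊓ satRange (weylRep k lam) q :=
    ⟨theta_lineVec k lam, lineVec_mem_satRange k lam (p := p) hq⟩
  exact nonempty_cokernel_ofLE_iso _ _ (gker_inf_gim_eq _ (q + 1)) (gker_inf_gim_eq _ q) _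
    (subsheafInclOfLE (inf_le_inf le_rfl (satRange_succ_le _ q))) (subsheafInclOfLE_comp _)
    (lineMap hw) (fun Z g g' hg => eq_zero_of_comp_lineMap (p := p) hi _ inf_le_right hw hg)
    (fun Z g hg hg' => eq_zero_of_lineMap_comp hip hi _ le_rfl inf_le_left hw hg hg')

theorem isZero_sheafF [Fact p.Prime] (hip : q + 1 < p)
    (h : ¬ p ∣ lam.descFactorial (q + 1) ∨ p ∣ lam.descFactorial q) :
    IsZero (sheafF (weylRep k lam) (q + 1)) := by
  refine isZero_cokernel_ofLE _ ?_
  rw [gker_inf_gim_eq, gker_inf_gim_eq]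
  exact Subobject.mk_le_mk_of_comm _ (subsheafInclOfLE_comp
    (ker_inf_satRange_le k lam hip h))

end Sheaf

end WeylSheaf
end

theorem mainTheorem2 {k : Type*} [Field k] [IsAlgClosed k] (p : ℕ) [Fact p.Prime] [CharP k p]
    (lam : ℕ) (hV : WeylSheaf.IsIndecomposable (WeylSheaf.weylRep k lam))
    (i : ℕ) (hi : 1 ≤ i) (hip : i < p) :
    (i ≡ lam + 1 [MOD p] →
      Nonempty (WeylSheaf.sheafF (WeylSheaf.weylRep k lam) i ≅ WeylSheaf.O k (-(lam : ℤ)))) ∧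
    (¬ i ≡ lam + 1 [MOD p] →
      CategoryTheory.Limits.IsZero (WeylSheaf.sheafF (WeylSheaf.weylRep k lam) i)) := by
  obtain ⟨q, rfl⟩ := Nat.exists_eq_add_of_le' hi
  have hp : p.Prime := Fact.out
  have hmod : q + 1 ≡ lam + 1 [MOD p] ↔ lam % p = q := by
    rw [Nat.ModEq.add_iff_right rfl, Nat.ModEq, Nat.mod_eq_of_lt (by omega : q < p), eq_comm]
  have hsucc := WeylSheaf.prime_dvd_descFactorial_iff hp (n := lam) (i := q + 1)
  have hq := WeylSheaf.prime_dvd_descFactorial_iff hp (n := lam) (i := q)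
  rw [hmod]
  exact ⟨fun h => WeylSheaf.nonempty_sheafF_iso k lam hip (by omega) (by omega),
    fun h => WeylSheaf.isZero_sheafF k lam hip (by omega)⟩
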